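/- For $\ell>0$ let $H_\ell\subset\mathbb H^2$ be a (convex) right-angled hexagon in the hyperbolic plane with three pairwise non-consecutive sides of length $\ell/2$, and let $\Gamma_\ell<\mathrm{Isom}(\mathbb H^2)$ be the group generated by the reflections in (the geodesics containing) these three sides. Let $\delta_\ell$ be the Hausdorff dimension of the limit set of $\Gamma_\ell$ in the circle $\partial\mathbb H^2$. Let $\mathbf o\in H_\ell$ be the point that is equidistant from the three sides of length $\ell/2$, and let $C_\ell$ be its distance from each of them. For $R>0$ let $$N_\ell(R)=\#\{x\in\Gamma_\ell\cdot\mathbf o\;:\; d(\mathbf o,x)<R\}.$$ Then for all $\ell\ge 1$ and all $R>0$ the number $N_\ell(R)$ is finite and $$\frac{\log N_\ell(R)}{R}\;\ge\;\delta_\ell-\frac{\ell+8C_\ell+\log(20/3)}{R}.$$ -/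

import Mathlib

open scoped UpperHalfPlane

namespace HexReflection

noncomputable section

/-- In the coordinates `(Re z, |z|²)` the geodesics of the upper half-plane
(the half-circles and half-lines `a |z|² + b Re z + c = 0` orthogonal to the real axis) are straight.
`orient p q z` is the orientation determinant of the triple `p, q, z` in these coordinates.
For `p ≠ q` it vanishes exactly when `z` is on the complete geodesic through `p` and `q`, and it is
positive exactly when `z` is in the open half-plane to the left of the geodesic directed
from `p` to `q`. -/
def orient (p q z : ℍ) : ℝ :=
  (q.re - p.re) * (Complex.normSq z - Complex.normSq p)
    - (Complex.normSq q - Complex.normSq p) * (z.re - p.re)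

/-- The complete geodesic through two distinct points. -/
def geodesicLine (p q : ℍ) : Set ℍ := {z | orient p q z = 0}

/-- The geodesic segment between two points. -/
def geodesicSegment (p q : ℍ) : Set ℍ := {z | dist p z + dist z q = dist p q}

/-- The hyperbolic angle at `q` between the geodesic segments from `q` to `p` and from `q` to `r`
(where `p ≠ q` and `r ≠ q`), computed by the hyperbolic law of cosines. -/
def hypAngle (p q r : ℍ) : ℝ :=
  Real.arccos ((Real.cosh (dist q p) * Real.cosh (dist q r) - Real.cosh (dist p r)) /
    (Real.sinh (dist q p) * Real.sinh (dist q r)))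

/-- `v` lists, in counterclockwise order, the vertices of a convex hexagon
(for every side, the four other vertices are strictly to the left of it)
all of whose interior angles are right angles. -/
structure IsRightAngledHexagon (v : ZMod 6 → ℍ) : Prop where
  convex : ∀ i j : ZMod 6, j ≠ i → j ≠ i + 1 → 0 < orient (v i) (v (i + 1)) (v j)
  right_angle : ∀ i : ZMod 6, hypAngle (v (i - 1)) (v i) (v (i + 1)) = Real.pi / 2

/-- The closed region bounded by the convex hexagon with counterclockwise vertices `v`. -/
def hexagon (v : ZMod 6 → ℍ) : Set ℍ := {z | ∀ i : ZMod 6, 0 ≤ orient (v i) (v (i + 1)) z}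

/-- The `i`-th side of the hexagon. -/
def side (v : ZMod 6 → ℍ) (i : ZMod 6) : Set ℍ := geodesicSegment (v i) (v (i + 1))

/-- Indices of three pairwise non-consecutive sides of a hexagon. -/
def altSides : Set (ZMod 6) := {0, 2, 4}

/-- `r` is the reflection in the geodesic `L`: the isometry whose fixed points are exactly
the points of `L`. -/
def IsReflection (r : ℍ ≃ᵢ ℍ) (L : Set ℍ) : Prop := ∀ z : ℍ, r z = z ↔ z ∈ L

/-- The group generated by the reflections in (the complete geodesics containing) the three
sides `0, 2, 4` of the hexagon. -/
def reflectionGroup (v : ZMod 6 → ℍ) : Subgroup (ℍ ≃ᵢ ℍ) :=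
  Subgroup.closure {r | ∃ i ∈ altSides, IsReflection r (geodesicLine (v i) (v (i + 1)))}

/-- The orbit of a point under a group of isometries. -/
def orbit (Γ : Subgroup (ℍ ≃ᵢ ℍ)) (z : ℍ) : Set ℍ := {x | ∃ γ ∈ Γ, γ z = x}

/-- The Cayley transform, from the upper half-plane to the open unit disk. -/
def cayley (z : ℍ) : ℂ := ((z : ℂ) - Complex.I) / ((z : ℂ) + Complex.I)

/-- The limit set of a group of isometries of the hyperbolic plane, as a subset of the
unit circle, the boundary of the disk model: the points of the circle at which some
(equivalently, every) orbit accumulates. -/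
def limitSet (Γ : Subgroup (ℍ ≃ᵢ ℍ)) : Set ℂ :=
  {ξ | ‖ξ‖ = 1 ∧ ∃ z : ℍ, ξ ∈ closure (cayley '' orbit Γ z)}

/-- The Hausdorff dimension of the limit set. -/
def limitDim (Γ : Subgroup (ℍ ≃ᵢ ℍ)) : ℝ := (dimH (limitSet Γ)).toReal

/-- The dimension is finite, so that `limitDim` loses nothing by taking real values. -/
theorem ofReal_limitDim (Γ : Subgroup (ℍ ≃ᵢ ℍ)) :
    ENNReal.ofReal (limitDim Γ) = dimH (limitSet Γ) := by
  apply ENNReal.ofReal_toReal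
  have h : dimH (limitSet Γ) ≤ dimH (Set.univ : Set ℂ) := dimH_mono (Set.subset_univ _)
  rw [Real.dimH_univ_eq_finrank] at h
  exact ne_top_of_le_ne_top (ENNReal.natCast_ne_top _) h

/-- The orbit points of `o` at distance less than `R` from `o`. -/
def orbitBall (Γ : Subgroup (ℍ ≃ᵢ ℍ)) (o : ℍ) (R : ℝ) : Set ℍ :=
  orbit Γ o ∩ Metric.ball o R

/-- The number of orbit points of `o` at distance less than `R` from `o`. -/
def orbitCount (Γ : Subgroup (ℍ ≃ᵢ ℍ)) (o : ℍ) (R : ℝ) : ℕ := (orbitBall Γ o R).ncard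

end

end HexReflection

/-! The three generators play ping-pong: a reduced word moves `o` across the side of its first
letter, so the orbit is discrete and each element of the group has a coarsely unique path. The
geodesic from `o` to `(l ++ m).prod o` crosses the translate by `l` of the side of the last letter
of `l`, not merely the line through that side. It therefore passes within `D = C + ℓ / 2` of `l.prod
o` (`dist_add_dist_le`). One letter moves `o` by at most `2 * C`, so the way to any orbit point
passes near orbit points at every prescribed distance: `IsCoarselyGeodesic` holds with `c = 2 * C`
and `b = 2 * D`.

Cutting the way to an orbit point gives `N (T + Δ) ≤ N R * N T` with `Δ = R - (c + b)`, hence `N ((n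
+ 1) * Δ) ≤ N R ^ n * N Δ`. In the disk model, limit points are approximated up to a constant times
`exp (-T)` by orbit points at distance less than `T`. So at scale `exp (-n * Δ)` about `N R ^ n`
balls cover the limit set, and its dimension is at most `log (N R) / Δ`. Since the dimension is at
most 1 and `c + b = ℓ + 4 * C`, the claim follows.

The plane geometry is done on the hyperboloid: lines are given by unit normals, and `height` is the
pairing with a normal. -/

open scoped UpperHalfPlane

namespace HexReflection

noncomputable section

/-! ### The hyperboloid model -/

/-- The Lorentz form of signature `(1, 2)` on `ℝ³`, in null coordinates. -/
def lor (u w : ℝ × ℝ × ℝ) : ℝ := (u.1 * w.2.2 + u.2.2 * w.1) / 2 - u.2.1 * w.2.1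

/-- The point of the hyperboloid `lor u u = 1` that corresponds to a point of the upper half-plane. -/
def hvec (z : ℍ) : ℝ × ℝ × ℝ := (1 / z.im, z.re / z.im, Complex.normSq z / z.im)

theorem lor_comm (u w : ℝ × ℝ × ℝ) : lor u w = lor w u := by
  simp only [lor]; ring

theorem lor_add_left (u u' w : ℝ × ℝ × ℝ) : lor (u + u') w = lor u w + lor u' w := by
  simp only [lor, Prod.fst_add, Prod.snd_add]; ring

theorem lor_smul_left (c : ℝ) (u w : ℝ × ℝ × ℝ) : lor (c • u) w = c * lor u w := by
  simp only [lor, Prod.smul_fst, Prod.smul_snd, smul_eq_mul]; ring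

theorem lor_add_right (u w w' : ℝ × ℝ × ℝ) : lor u (w + w') = lor u w + lor u w' := by
  simp only [lor, Prod.fst_add, Prod.snd_add]; ring

theorem lor_smul_right (c : ℝ) (u w : ℝ × ℝ × ℝ) : lor u (c • w) = c * lor u w := by
  simp only [lor, Prod.smul_fst, Prod.smul_snd, smul_eq_mul]; ring

theorem normSq_coe_eq (z : ℍ) : Complex.normSq (z : ℂ) = z.re ^ 2 + z.im ^ 2 := by
  rw [Complex.normSq_apply, UpperHalfPlane.coe_re, UpperHalfPlane.coe_im]; ring

theorem lor_hvec (z w : ℍ) : lor (hvec z) (hvec w) = Real.cosh (dist z w) := by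
  have hz := z.im_pos
  have hw := w.im_pos
  rw [UpperHalfPlane.cosh_dist, Complex.dist_eq, ← Complex.normSq_eq_norm_sq]
  simp only [lor, hvec, Complex.normSq_apply, Complex.sub_re, Complex.sub_im,
    UpperHalfPlane.coe_re, UpperHalfPlane.coe_im]
  field_simp
  ring

theorem lor_hvec_self (z : ℍ) : lor (hvec z) (hvec z) = 1 := by
  rw [lor_hvec, dist_self, Real.cosh_zero]

theorem one_le_lor_hvec (z w : ℍ) : 1 ≤ lor (hvec z) (hvec w) := by
  rw [lor_hvec]; exact Real.one_le_cosh _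

theorem eq_of_lor_hvec_eq_one {z w : ℍ} (h : lor (hvec z) (hvec w) = 1) : z = w := by
  rw [lor_hvec] at h
  by_contra hne
  have := Real.one_lt_cosh.2 (dist_pos.2 hne).ne'
  linarith

theorem exists_hvec_eq {u : ℝ × ℝ × ℝ} (h : lor u u = 1) (hu : 0 < u.1) : ∃ z : ℍ, hvec z = u := by
  refine ⟨⟨⟨u.2.1 / u.1, 1 / u.1⟩, by simpa using hu⟩, ?_⟩
  have hu' := hu.ne'
  have h2 : u.1 * u.2.2 = 1 + u.2.1 ^ 2 := by simp only [lor] at h; linarith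
  refine Prod.ext ?_ (Prod.ext ?_ ?_)
  · simp [hvec, UpperHalfPlane.im]
  · simp [hvec, UpperHalfPlane.im, UpperHalfPlane.re]
    field_simp
  · simp only [hvec, Complex.normSq_apply, UpperHalfPlane.im]
    field_simp
    linarith

/-- A timelike vector that pairs positively with one point of the hyperboloid does so with all. -/
theorem lor_hvec_pos_of_timelike {u : ℝ × ℝ × ℝ} (hu : 0 < lor u u) {z : ℍ}
    (hz : 0 < lor u (hvec z)) (w : ℍ) : 0 < lor u (hvec w) := by
  -- Completing squares shows that the pairing with every point has the sign of `u.1`.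
  have h2 : ∀ x : ℍ, 0 < u.1 * lor u (hvec x) := by
    intro x
    have hx := x.im_pos
    have key : 2 * x.im * (u.1 * lor u (hvec x))
        = (u.1 * x.re - u.2.1) ^ 2 + (u.1 * x.im) ^ 2 + lor u u := by
      simp only [lor, hvec, normSq_coe_eq]
      field_simp
      ring
    have : 0 < 2 * x.im * (u.1 * lor u (hvec x)) := by
      rw [key]; positivity
    exact (mul_pos_iff_of_pos_left (by positivity)).1 this
  have h3 : 0 < u.1 := (mul_pos_iff_of_pos_right hz).1 (h2 z)
  exact (mul_pos_iff_of_pos_left h3).1 (h2 w)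

/-- The determinant of three vectors. -/
def det3 (u v w : ℝ × ℝ × ℝ) : ℝ :=
  u.1 * (v.2.1 * w.2.2 - v.2.2 * w.2.1) - u.2.1 * (v.1 * w.2.2 - v.2.2 * w.1)
    + u.2.2 * (v.1 * w.2.1 - v.2.1 * w.1)

/-- Gram determinant; the factor 4 appears because the matrix of `lor` has determinant 1/4. -/
theorem det3_sq (u v w : ℝ × ℝ × ℝ) : det3 u v w ^ 2 =
    4 * (lor u u * (lor v v * lor w w - lor v w ^ 2) - lor u v * (lor u v * lor w w - lor v w * lor u w)
      + lor u w * (lor u v * lor v w - lor v v * lor u w)) := by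
  simp only [det3, lor]; ring

/-- Cramer's rule. -/
theorem eq_zero_of_lor_eq_zero {u v w x : ℝ × ℝ × ℝ} (hd : det3 u v w ≠ 0)
    (hu : lor x u = 0) (hv : lor x v = 0) (hw : lor x w = 0) : x = 0 := by
  have h1 : det3 u v w * x.1 = 0 := by
    have : det3 u v w * x.1 = 2 * (lor x u * (v.1 * w.2.1 - v.2.1 * w.1)
        - lor x v * (u.1 * w.2.1 - u.2.1 * w.1) + lor x w * (u.1 * v.2.1 - u.2.1 * v.1)) := by
      simp only [det3, lor]; ring
    rw [this, hu, hv, hw]; ring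
  have h2 : det3 u v w * x.2.1 = 0 := by
    have : det3 u v w * x.2.1 = (lor x u * (v.1 * w.2.2 - v.2.2 * w.1)
        - lor x v * (u.1 * w.2.2 - u.2.2 * w.1) + lor x w * (u.1 * v.2.2 - u.2.2 * v.1)) := by
      simp only [det3, lor]; ring
    rw [this, hu, hv, hw]; ring
  have h3 : det3 u v w * x.2.2 = 0 := by
    have : det3 u v w * x.2.2 = 2 * (lor x u * (v.2.1 * w.2.2 - v.2.2 * w.2.1)
        - lor x v * (u.2.1 * w.2.2 - u.2.2 * w.2.1) + lor x w * (u.2.1 * v.2.2 - u.2.2 * v.2.1)) := by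
      simp only [det3, lor]; ring
    rw [this, hu, hv, hw]; ring
  exact Prod.ext ((mul_eq_zero_iff_left hd).1 h1)
    (Prod.ext ((mul_eq_zero_iff_left hd).1 h2) ((mul_eq_zero_iff_left hd).1 h3))

/-- An orthonormal frame of Lorentz space. -/
structure IsFrame (p e f : ℝ × ℝ × ℝ) : Prop where
  pp : lor p p = 1
  ee : lor e e = -1
  ff : lor f f = -1
  pe : lor e p = 0
  pf : lor f p = 0
  ef : lor e f = 0

theorem IsFrame.det3_ne_zero {p e f : ℝ × ℝ × ℝ} (h : IsFrame p e f) : det3 p e f ≠ 0 := by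
  intro h0
  have := det3_sq p e f
  rw [h0, lor_comm p e, lor_comm p f, h.pp, h.ee, h.ff, h.pe, h.pf, h.ef] at this
  norm_num at this

theorem IsFrame.expand {p e f : ℝ × ℝ × ℝ} (h : IsFrame p e f) (u : ℝ × ℝ × ℝ) :
    u = lor u p • p + (-lor u e) • e + (-lor u f) • f := by
  have : u + (-1 : ℝ) • (lor u p • p + (-lor u e) • e + (-lor u f) • f) = 0 := by
    apply eq_zero_of_lor_eq_zero h.det3_ne_zero <;>
    simp only [lor_add_left, lor_smul_left, lor_comm p e, lor_comm p f, lor_comm f e, h.pp, h.ee,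
      h.ff, h.pe, h.pf, h.ef] <;> ring
  rw [neg_one_smul, ← sub_eq_add_neg, sub_eq_zero] at this
  exact this

theorem IsFrame.lor_eq {p e f : ℝ × ℝ × ℝ} (h : IsFrame p e f) (u w : ℝ × ℝ × ℝ) :
    lor u w = lor u p * lor w p - lor u e * lor w e - lor u f * lor w f := by
  conv_lhs => rw [h.expand u]
  simp only [lor_add_left, lor_smul_left, lor_comm p w, lor_comm e w, lor_comm f w]
  ring

/-- A nonnegative combination of two points of the hyperboloid is, up to scaling, a point on the
segment between them. -/
theorem exists_mem_geodesicSegment (p q : ℍ) {a b : ℝ} (ha : 0 ≤ a) (hb : 0 ≤ b)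
    (hab : 0 < a + b) : ∃ x ∈ geodesicSegment p q, ∃ k : ℝ, 0 < k ∧
      ∀ w, lor (hvec x) w = k * (a * lor (hvec p) w + b * lor (hvec q) w) := by
  set c := lor (hvec p) (hvec q) with hc
  have hc1 : 1 ≤ c := one_le_lor_hvec p q
  have hN : 0 < a ^ 2 + b ^ 2 + 2 * a * b * c := by
    have := mul_nonneg (mul_nonneg ha hb) (sub_nonneg.2 hc1)
    have : 0 < (a + b) ^ 2 := by positivity
    nlinarith
  -- The factor that brings the combination back to the hyperboloid.
  set k := (√(a ^ 2 + b ^ 2 + 2 * a * b * c))⁻¹ with hk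
  have hk0 : 0 < k := by positivity
  have hk2 : k ^ 2 * (a ^ 2 + b ^ 2 + 2 * a * b * c) = 1 := by
    rw [hk, inv_pow, Real.sq_sqrt hN.le, inv_mul_cancel₀ hN.ne']
  have hp := lor_hvec_self p
  have hq := lor_hvec_self q
  have hcomm := lor_comm (hvec q) (hvec p)
  obtain ⟨x, hx⟩ := exists_hvec_eq (u := (k * a) • hvec p + (k * b) • hvec q) (by
    simp only [lor_add_left, lor_add_right, lor_smul_left, lor_smul_right, hp, hq, hcomm, ← hc]
    linear_combination hk2) (by
    have h1 : 0 < (hvec p).1 := by simp only [hvec]; have := p.im_pos; positivity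
    have h2 : 0 < (hvec q).1 := by simp only [hvec]; have := q.im_pos; positivity
    simp only [Prod.fst_add, Prod.smul_fst, smul_eq_mul]
    rcases ha.eq_or_lt with h | h
    · have : 0 < b := by linarith
      rw [← h]; simp only [mul_zero, zero_mul, zero_add]; positivity
    · positivity)
  have hw : ∀ w, lor (hvec x) w = k * (a * lor (hvec p) w + b * lor (hvec q) w) := by
    intro w
    rw [hx, lor_add_left, lor_smul_left, lor_smul_left]; ring
  refine ⟨x, ?_, k, hk0, hw⟩
  set A := k * a
  set B := k * b
  have hA : 0 ≤ A := by positivity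
  have hB : 0 ≤ B := by positivity
  have hAB : A ^ 2 + B ^ 2 + 2 * A * B * c = 1 := by linear_combination hk2
  have h1 : Real.cosh (dist p x) = A + B * c := by
    rw [← lor_hvec, lor_comm, hw, hp, hcomm]; ring
  have h2 : Real.cosh (dist x q) = A * c + B := by
    rw [← lor_hvec, hw, hq]; ring
  have h3 : Real.cosh (dist p q) = c := (lor_hvec p q).symm
  have s0 : 0 ≤ Real.sinh (dist p q) := Real.sinh_nonneg_iff.2 dist_nonneg
  have s3 : Real.sinh (dist p q) ^ 2 = c ^ 2 - 1 := by rw [Real.sinh_sq, h3]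
  have s1 : Real.sinh (dist p x) = B * Real.sinh (dist p q) := by
    refine (pow_left_inj₀ (Real.sinh_nonneg_iff.2 dist_nonneg) (by positivity) two_ne_zero).1 ?_
    rw [Real.sinh_sq, h1, mul_pow, s3]; linear_combination hAB
  have s2 : Real.sinh (dist x q) = A * Real.sinh (dist p q) := by
    refine (pow_left_inj₀ (Real.sinh_nonneg_iff.2 dist_nonneg) (by positivity) two_ne_zero).1 ?_
    rw [Real.sinh_sq, h2, mul_pow, s3]; linear_combination hAB
  -- The addition formula for cosh turns the normalisation `hAB` into additivity of distances.
  have h4 : Real.cosh (dist p x + dist x q) = Real.cosh (dist p q) := by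
    rw [Real.cosh_add, h1, h2, h3, s1, s2]
    linear_combination c * hAB + A * B * s3
  exact Real.cosh_strictMonoOn.injOn (add_nonneg dist_nonneg dist_nonneg) dist_nonneg h4

theorem orient_eq_det3 (p q z : ℍ) :
    orient p q z = p.im * q.im * z.im * det3 (hvec p) (hvec q) (hvec z) := by
  have hp := p.im_pos
  have hq := q.im_pos
  have hz := z.im_pos
  simp only [orient, det3, hvec]
  field_simp
  ring

/-- The Gram determinant of three points vanishes when their distances add up. -/
theorem orient_eq_zero_of_mem_geodesicSegment {p q x : ℍ} (hx : x ∈ geodesicSegment p q) :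
    orient p q x = 0 := by
  have h : dist p x + dist x q = dist p q := hx
  have hd : det3 (hvec p) (hvec q) (hvec x) ^ 2 = 0 := by
    rw [det3_sq, lor_comm (hvec q) (hvec x)]
    simp only [lor_hvec, dist_self, Real.cosh_zero]
    rw [← h, Real.cosh_add]
    have h1 := Real.cosh_sq (dist p x)
    have h2 := Real.cosh_sq (dist x q)
    generalize Real.cosh (dist p x) = a at *
    generalize Real.cosh (dist x q) = b at *
    generalize Real.sinh (dist p x) = s at *
    generalize Real.sinh (dist x q) = t at *
    have h1' : s ^ 2 = a ^ 2 - 1 := by linarith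
    have h2' : t ^ 2 = b ^ 2 - 1 := by linarith
    linear_combination (-4 * t ^ 2) * h1' - 4 * (a ^ 2 - 1) * h2'
  rw [orient_eq_det3, pow_eq_zero_iff two_ne_zero |>.1 hd, mul_zero]

/-- The unit normal of the geodesic directed from `p` to `q`. -/
def unitNormal (p q : ℍ) : ℝ × ℝ × ℝ :=
  let P := hvec p
  let Q := hvec q
  (1 / √(lor P Q ^ 2 - 1)) •
    (P.1 * Q.2.1 - P.2.1 * Q.1, (P.1 * Q.2.2 - P.2.2 * Q.1) / 2, P.2.1 * Q.2.2 - P.2.2 * Q.2.1)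

theorem unitNormal_scale_pos {p q : ℍ} (h : p ≠ q) : 0 < lor (hvec p) (hvec q) ^ 2 - 1 := by
  have : 1 < lor (hvec p) (hvec q) := by
    rw [lor_hvec]; exact Real.one_lt_cosh.2 (dist_pos.2 h).ne'
  nlinarith

/-- `unitNormal` is a normalised Lorentz cross product, so pairing with it is a triple product. -/
theorem lor_unitNormal (p q : ℍ) (w : ℝ × ℝ × ℝ) :
    lor (unitNormal p q) w = 1 / √(lor (hvec p) (hvec q) ^ 2 - 1) * (det3 (hvec p) (hvec q) w / 2) := by
  simp only [unitNormal]
  rw [lor_smul_left]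
  congr 1
  simp only [lor, det3]; ring

theorem orient_eq_lor_unitNormal {p q : ℍ} (h : p ≠ q) (z : ℍ) : ∃ k : ℝ, 0 < k ∧
    orient p q z = k * lor (unitNormal p q) (hvec z) := by
  have h0 := unitNormal_scale_pos h
  have hp := p.im_pos
  have hq := q.im_pos
  have hz := z.im_pos
  refine ⟨p.im * q.im * z.im * 2 * √(lor (hvec p) (hvec q) ^ 2 - 1), by positivity, ?_⟩
  rw [lor_unitNormal, orient_eq_det3]
  field_simp

theorem lor_unitNormal_self {p q : ℍ} (h : p ≠ q) : lor (unitNormal p q) (unitNormal p q) = -1 := by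
  have h0 := unitNormal_scale_pos h
  simp only [unitNormal]
  rw [lor_smul_left, lor_smul_right, ← mul_assoc]
  have h1 : 1 / √(lor (hvec p) (hvec q) ^ 2 - 1) * (1 / √(lor (hvec p) (hvec q) ^ 2 - 1))
      = (lor (hvec p) (hvec q) ^ 2 - 1)⁻¹ := by
    rw [div_mul_div_comm, Real.mul_self_sqrt h0.le, one_mul, one_div]
  rw [h1, inv_mul_eq_iff_eq_mul₀ h0.ne']
  have hp := lor_hvec_self p
  have hq := lor_hvec_self q
  have : ∀ P Q : ℝ × ℝ × ℝ, lor
      (P.1 * Q.2.1 - P.2.1 * Q.1, (P.1 * Q.2.2 - P.2.2 * Q.1) / 2, P.2.1 * Q.2.2 - P.2.2 * Q.2.1)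
      (P.1 * Q.2.1 - P.2.1 * Q.1, (P.1 * Q.2.2 - P.2.2 * Q.1) / 2, P.2.1 * Q.2.2 - P.2.2 * Q.2.1)
      = lor P P * lor Q Q - lor P Q ^ 2 := by
    intro P Q; simp only [lor]; ring
  rw [this, hp, hq]; ring

/-- The hypothesis is the hyperbolic Pythagorean theorem for a right angle at `q`; the Binet–Cauchy
identity for cross products turns it into orthogonality of the normals. -/
theorem lor_unitNormal_unitNormal {p q r : ℍ} (h : lor (hvec q) (hvec p) * lor (hvec q) (hvec r)
    = lor (hvec p) (hvec r)) : lor (unitNormal p q) (unitNormal q r) = 0 := by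
  simp only [unitNormal]
  rw [lor_smul_left, lor_smul_right]
  have hq := lor_hvec_self q
  have : ∀ P Q R : ℝ × ℝ × ℝ, lor
      (P.1 * Q.2.1 - P.2.1 * Q.1, (P.1 * Q.2.2 - P.2.2 * Q.1) / 2, P.2.1 * Q.2.2 - P.2.2 * Q.2.1)
      (Q.1 * R.2.1 - Q.2.1 * R.1, (Q.1 * R.2.2 - Q.2.2 * R.1) / 2, Q.2.1 * R.2.2 - Q.2.2 * R.2.1)
      = lor Q P * lor Q R - lor P R * lor Q Q := by
    intro P Q R; simp only [lor]; ring
  rw [this, hq, h]; ring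

/-! ### Normals and half-planes of a right-angled hexagon -/

/-- The inner unit normal of the `i`-th side. -/
def sideNormal (v : ZMod 6 → ℍ) (i : ZMod 6) : ℝ × ℝ × ℝ := unitNormal (v i) (v (i + 1))

/-- The signed position of a point relative to the line containing the `i`-th side. -/
def height (v : ZMod 6 → ℍ) (i : ZMod 6) (z : ℍ) : ℝ := lor (sideNormal v i) (hvec z)

namespace IsRightAngledHexagon

theorem vertex_ne {v : ZMod 6 → ℍ} (hv : IsRightAngledHexagon v) (i : ZMod 6) : v i ≠ v (i + 1) := by
  intro h
  have := hv.convex i (i + 2) (by clear * -; decide +revert) (by clear * -; decide +revert)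
  rw [← h] at this
  simp [orient] at this

theorem orient_pos_iff {v : ZMod 6 → ℍ} (hv : IsRightAngledHexagon v) (i : ZMod 6) (z : ℍ) :
    0 < orient (v i) (v (i + 1)) z ↔ 0 < height v i z := by
  obtain ⟨k, hk, h⟩ := orient_eq_lor_unitNormal (hv.vertex_ne i) z
  rw [h]; exact mul_pos_iff_of_pos_left hk

theorem orient_nonneg_iff {v : ZMod 6 → ℍ} (hv : IsRightAngledHexagon v) (i : ZMod 6) (z : ℍ) :
    0 ≤ orient (v i) (v (i + 1)) z ↔ 0 ≤ height v i z := by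
  obtain ⟨k, hk, h⟩ := orient_eq_lor_unitNormal (hv.vertex_ne i) z
  rw [h]; exact mul_nonneg_iff_of_pos_left hk

theorem mem_geodesicLine_iff {v : ZMod 6 → ℍ} (hv : IsRightAngledHexagon v) (i : ZMod 6) (z : ℍ) :
    z ∈ geodesicLine (v i) (v (i + 1)) ↔ height v i z = 0 := by
  obtain ⟨k, hk, h⟩ := orient_eq_lor_unitNormal (hv.vertex_ne i) z
  show orient _ _ _ = 0 ↔ _
  rw [h]; exact mul_eq_zero_iff_left hk.ne'

theorem height_eq_zero_of_mem_side {v : ZMod 6 → ℍ} (hv : IsRightAngledHexagon v) {i : ZMod 6} {z : ℍ} (hz : z ∈ side v i) : height v i z = 0 :=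
  (hv.mem_geodesicLine_iff i z).1 (orient_eq_zero_of_mem_geodesicSegment hz)

theorem height_left {v : ZMod 6 → ℍ} (hv : IsRightAngledHexagon v) (i : ZMod 6) : height v i (v i) = 0 :=
  (hv.mem_geodesicLine_iff i _).1 (by simp [geodesicLine, orient])

theorem height_right {v : ZMod 6 → ℍ} (hv : IsRightAngledHexagon v) (i : ZMod 6) : height v i (v (i + 1)) = 0 :=
  (hv.mem_geodesicLine_iff i _).1 (by simp [geodesicLine, orient]; ring)

theorem height_vertex_pos {v : ZMod 6 → ℍ} (hv : IsRightAngledHexagon v) {i j : ZMod 6} (h1 : j ≠ i) (h2 : j ≠ i + 1) : 0 < height v i (v j) :=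
  (hv.orient_pos_iff i _).1 (hv.convex i j h1 h2)

theorem lor_normal_self {v : ZMod 6 → ℍ} (hv : IsRightAngledHexagon v) (i : ZMod 6) : lor (sideNormal v i) (sideNormal v i) = -1 :=
  lor_unitNormal_self (hv.vertex_ne i)

theorem lor_normal_succ {v : ZMod 6 → ℍ} (hv : IsRightAngledHexagon v) (i : ZMod 6) : lor (sideNormal v i) (sideNormal v (i + 1)) = 0 := by
  apply lor_unitNormal_unitNormal
  have h := hv.right_angle (i + 1)
  rw [add_sub_cancel_right, hypAngle, Real.arccos_eq_pi_div_two] at h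
  have h1 : dist (v (i + 1)) (v i) ≠ 0 := (dist_pos.2 (hv.vertex_ne i).symm).ne'
  have h2 : dist (v (i + 1)) (v (i + 1 + 1)) ≠ 0 := (dist_pos.2 (hv.vertex_ne (i + 1))).ne'
  have h3 : Real.sinh (dist (v (i + 1)) (v i)) * Real.sinh (dist (v (i + 1)) (v (i + 1 + 1))) ≠ 0 :=
    mul_ne_zero (Real.sinh_ne_zero.2 h1) (Real.sinh_ne_zero.2 h2)
  rw [div_eq_zero_iff, or_iff_left h3, sub_eq_zero] at h
  simpa only [lor_hvec] using h

/-- The frame at a vertex. -/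
theorem isFrame {v : ZMod 6 → ℍ} (hv : IsRightAngledHexagon v) (i : ZMod 6) :
    IsFrame (hvec (v (i + 1))) (sideNormal v i) (sideNormal v (i + 1)) where
  pp := lor_hvec_self _
  ee := hv.lor_normal_self i
  ff := hv.lor_normal_self _
  pe := hv.height_right i
  pf := hv.height_left (i + 1)
  ef := hv.lor_normal_succ i

/-- Sides `i` and `i + 2` have side `i + 1` as common perpendicular, so their lines are
ultraparallel. In the frame at `v (i + 1)` the norm of the second normal gives `g ^ 2 = 1 + x ^ 2`;
its vanishing at `v (i + 2)` gives the sign of `g`. -/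
theorem one_lt_lor_normal_add_two {v : ZMod 6 → ℍ} (hv : IsRightAngledHexagon v) (i : ZMod 6) :
    1 < lor (sideNormal v i) (sideNormal v (i + 2)) := by
  have hF := hv.isFrame i
  set g := lor (sideNormal v i) (sideNormal v (i + 2)) with hg
  set x := height v (i + 2) (v (i + 1)) with hx
  have hx0 : 0 < x := hv.height_vertex_pos (by clear * -; decide +revert) (by clear * -; decide +revert)
  have h2 : lor (sideNormal v (i + 2)) (sideNormal v (i + 1)) = 0 := by
    rw [lor_comm]
    have := hv.lor_normal_succ (i + 1)
    rwa [add_assoc, one_add_one_eq_two] at this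
  have h1 : -1 = x * x - g * g := by
    have := hF.lor_eq (sideNormal v (i + 2)) (sideNormal v (i + 2))
    rw [h2, hv.lor_normal_self, lor_comm _ (sideNormal v i), ← hg] at this
    rw [hx, height]; linear_combination this
  have h3 : 0 < g := by
    have := hF.lor_eq (sideNormal v (i + 2)) (hvec (v (i + 2)))
    have hl : lor (sideNormal v (i + 2)) (hvec (v (i + 2))) = 0 := hv.height_left _
    rw [h2, hl, lor_comm _ (sideNormal v i), ← hg, lor_comm _ (sideNormal v i)] at this
    have hc := one_le_lor_hvec (v (i + 2)) (v (i + 1))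
    have hp : 0 < lor (sideNormal v i) (hvec (v (i + 2))) :=
      hv.height_vertex_pos (by clear * -; decide +revert) (by clear * -; decide +revert)
    have h5 : 0 < x * lor (hvec (v (i + 2))) (hvec (v (i + 1))) := by positivity
    have h6 : x * lor (hvec (v (i + 2))) (hvec (v (i + 1)))
        = g * lor (sideNormal v i) (hvec (v (i + 2))) := by
      rw [hx, height]; linear_combination -this
    rw [h6] at h5
    exact (mul_pos_iff_of_pos_right hp).1 h5
  nlinarith

/-- In the frame at `v (i + 2)` orthogonality kills the two spacelike terms, leaving a product of
two positive heights. -/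
theorem lor_normal_add_three_pos {v : ZMod 6 → ℍ} (hv : IsRightAngledHexagon v) (i : ZMod 6) :
    0 < lor (sideNormal v i) (sideNormal v (i + 3)) := by
  have e2 : i + 1 + 1 = i + 2 := by ring
  have e3 : i + 2 + 1 = i + 3 := by ring
  have hF := hv.isFrame (i + 1)
  have h1 := hv.lor_normal_succ i
  have h2 := hv.lor_normal_succ (i + 2)
  rw [e3, lor_comm] at h2
  rw [hF.lor_eq, e2, h1, h2]
  have h3 : 0 < lor (sideNormal v i) (hvec (v (i + 2))) :=
    hv.height_vertex_pos (by clear * -; decide +revert) (by clear * -; decide +revert)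
  have h4 : 0 < lor (sideNormal v (i + 3)) (hvec (v (i + 2))) :=
    hv.height_vertex_pos (by clear * -; decide +revert) (by clear * -; decide +revert)
  have := mul_pos h3 h4
  linarith

/-- The sum of the two normals is timelike, so its sign can be read off at the vertex `v (i + 4)`.
Consequently the outer half-planes of two alternate sides are disjoint. -/
theorem height_add_height_pos {v : ZMod 6 → ℍ} (hv : IsRightAngledHexagon v) (i : ZMod 6) (z : ℍ) : 0 < height v i z + height v (i + 2) z := by
  have hg := hv.one_lt_lor_normal_add_two i
  have h : 0 < lor (sideNormal v i + sideNormal v (i + 2)) (hvec z) := by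
    refine lor_hvec_pos_of_timelike ?_ (z := v (i + 4)) ?_ z
    · rw [lor_add_left, lor_add_right, lor_add_right, hv.lor_normal_self, hv.lor_normal_self,
        lor_comm (sideNormal v (i + 2))]
      linarith
    · rw [lor_add_left]
      exact add_pos (hv.height_vertex_pos (by clear * -; decide +revert) (by clear * -; decide +revert))
        (hv.height_vertex_pos (by clear * -; decide +revert) (by clear * -; decide +revert))
  rwa [lor_add_left] at h

/-- The region beyond side `i` and between the lines of its two neighbours stays on the inner side
of the opposite side. This keeps the hull stable in `ping_pong`. -/
theorem height_add_three_pos {v : ZMod 6 → ℍ} (hv : IsRightAngledHexagon v) {i : ZMod 6} {z : ℍ} (h0 : height v i z < 0)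
    (h1 : 0 ≤ height v (i + 1) z) (h5 : 0 ≤ height v (i - 1) z) : 0 < height v (i + 3) z := by
  have hF := hv.isFrame i
  have e := hF.lor_eq (sideNormal v (i + 3)) (hvec z)
  have e' := hF.lor_eq (sideNormal v (i - 1)) (hvec z)
  have e'' := hF.lor_eq (sideNormal v (i - 1)) (sideNormal v (i + 3))
  have en := hF.lor_eq (sideNormal v (i - 1)) (sideNormal v (i - 1))
  have z1 : lor (sideNormal v (i - 1)) (sideNormal v i) = 0 := by
    have := hv.lor_normal_succ (i - 1)
    rwa [sub_add_cancel] at this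
  have g13 : 1 < lor (sideNormal v (i + 3)) (sideNormal v (i + 1)) := by
    have := hv.one_lt_lor_normal_add_two (i + 1)
    rwa [show i + 1 + 2 = i + 3 by ring, lor_comm] at this
  have g35 : 1 < lor (sideNormal v (i - 1)) (sideNormal v (i + 3)) := by
    have := hv.one_lt_lor_normal_add_two (i + 3)
    rwa [show i + 3 + 2 = i - 1 by clear * -; decide +revert, lor_comm] at this
  have g51 : 1 < lor (sideNormal v (i - 1)) (sideNormal v (i + 1)) := by
    have := hv.one_lt_lor_normal_add_two (i - 1)
    rwa [show i - 1 + 2 = i + 1 by ring] at this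
  have g03 : 0 < lor (sideNormal v (i + 3)) (sideNormal v i) := by
    rw [lor_comm]; exact hv.lor_normal_add_three_pos i
  have px : 0 < lor (sideNormal v (i - 1)) (hvec (v (i + 1))) :=
    hv.height_vertex_pos (by clear * -; decide +revert) (by clear * -; decide +revert)
  have py : 0 < lor (sideNormal v (i + 3)) (hvec (v (i + 1))) :=
    hv.height_vertex_pos (by clear * -; decide +revert) (by clear * -; decide +revert)
  rw [z1] at e' e'' en
  rw [hv.lor_normal_self] at en
  simp only [height, lor_comm _ (hvec z)] at *
  generalize lor (sideNormal v (i - 1)) (hvec (v (i + 1))) = x at *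
  generalize lor (sideNormal v (i + 3)) (hvec (v (i + 1))) = y at *
  generalize lor (sideNormal v (i - 1)) (sideNormal v (i + 1)) = h at *
  generalize lor (sideNormal v (i + 3)) (sideNormal v (i + 1)) = u at *
  generalize lor (sideNormal v (i + 3)) (sideNormal v i) = g at *
  generalize lor (sideNormal v (i - 1)) (sideNormal v (i + 3)) = w at *
  generalize lor (hvec z) (hvec (v (i + 1))) = p at *
  generalize lor (hvec z) (sideNormal v (i + 1)) = q at *
  generalize lor (hvec z) (sideNormal v i) = r at *
  rw [e]
  -- In the frame at `v (i + 1)` the height sought is `y * p - u * q - g * r`. Here `k1` is the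
  -- condition on side `i - 1`, `k2` comes from `w > 1`, and `en` says `x ^ 2 = h ^ 2 - 1`;
  -- multiplying `k1` by `k2` bounds the first two terms.
  have k1 : h * q ≤ x * p := by linarith
  have k2 : u * h ≤ x * y := by linarith
  have k3 : 0 < -(g * r) := by nlinarith
  have k4 : 0 ≤ y * p - u * q := by
    have a1 : u * h * (h * q) ≤ (x * y) * (h * q) :=
      mul_le_mul_of_nonneg_right k2 (by positivity)
    have a2 : (x * y) * (h * q) ≤ (x * y) * (x * p) :=
      mul_le_mul_of_nonneg_left k1 (by positivity)
    have a3 : x ^ 2 * (u * q) ≤ h ^ 2 * (u * q) :=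
      mul_le_mul_of_nonneg_right (by nlinarith) (by positivity)
    have : 0 ≤ x ^ 2 * (y * p - u * q) := by nlinarith
    exact (mul_nonneg_iff_of_pos_left (by positivity)).1 this
  nlinarith

/-- A point on the line is a combination of the two end vertices. Height `i + 1` vanishes at one of
them and height `i - 1` at the other, so their signs are those of the coefficients. -/
theorem mem_side_of_height {v : ZMod 6 → ℍ} (hv : IsRightAngledHexagon v) {i : ZMod 6} {z : ℍ} (h0 : height v i z = 0)
    (h1 : 0 ≤ height v (i + 1) z) (h5 : 0 ≤ height v (i - 1) z) : z ∈ side v i := by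
  have hF := hv.isFrame i
  have px : 0 < lor (sideNormal v (i - 1)) (hvec (v (i + 1))) :=
    hv.height_vertex_pos (by clear * -; decide +revert) (by clear * -; decide +revert)
  have py : 0 < lor (hvec (v i)) (sideNormal v (i + 1)) := by
    rw [lor_comm]
    exact hv.height_vertex_pos (by clear * -; decide +revert) (by clear * -; decide +revert)
  have z1 : lor (sideNormal v (i - 1)) (sideNormal v i) = 0 := by
    have := hv.lor_normal_succ (i - 1)
    rwa [sub_add_cancel] at this
  have z2 : lor (sideNormal v (i - 1)) (hvec (v i)) = 0 := by
    have := hv.height_right (i - 1)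
    rwa [sub_add_cancel] at this
  have z3 : lor (hvec (v i)) (sideNormal v i) = 0 := by
    rw [lor_comm]; exact hv.height_left i
  simp only [height] at h0 h5 h1
  rw [lor_comm] at h0 h1
  have e1 := hF.lor_eq (sideNormal v (i - 1)) (hvec z)
  have e2 := hF.lor_eq (sideNormal v (i - 1)) (hvec (v i))
  rw [z1] at e1 e2
  rw [z2] at e2
  set a := lor (hvec z) (sideNormal v (i + 1)) / lor (hvec (v i)) (sideNormal v (i + 1)) with ha
  have ha' : lor (hvec z) (sideNormal v (i + 1)) = a * lor (hvec (v i)) (sideNormal v (i + 1)) := by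
    rw [ha, div_mul_cancel₀ _ py.ne']
  set b := lor (hvec z) (hvec (v (i + 1))) - a * lor (hvec (v i)) (hvec (v (i + 1))) with hb
  have ha0 : 0 ≤ a := div_nonneg h1 py.le
  have hb0 : 0 ≤ b := by
    have : lor (sideNormal v (i - 1)) (hvec (v (i + 1))) * b
        = lor (sideNormal v (i - 1)) (hvec z) := by
      rw [e1, hb, ha']; linear_combination a * e2
    rw [← this] at h5
    exact (mul_nonneg_iff_of_pos_left px).1 h5
  have hz : ∀ w, lor (hvec z) w = a * lor (hvec (v i)) w + b * lor (hvec (v (i + 1))) w := by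
    intro w
    rw [hF.lor_eq (hvec z), hF.lor_eq (hvec (v i)), hF.lor_eq (hvec (v (i + 1))), h0, z3, ha',
      lor_hvec_self, lor_comm (hvec (v (i + 1))), lor_comm (hvec (v (i + 1))), hF.pe, hF.pf, hb]
    ring
  have hab : 0 < a + b := by
    rcases (add_nonneg ha0 hb0).eq_or_lt with h | h
    · have h3 : a = 0 := by linarith
      have h4 : b = 0 := by linarith
      have := hz (hvec z)
      rw [lor_hvec_self, h3, h4] at this
      norm_num at this
    · exact h
  obtain ⟨x, hx, k, hk, hxw⟩ := exists_mem_geodesicSegment (v i) (v (i + 1)) ha0 hb0 hab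
  have hxw' : ∀ w, lor (hvec x) w = k * lor (hvec z) w := fun w => by rw [hxw, hz]
  have k1 := hxw' (hvec x)
  have k2 := hxw' (hvec z)
  rw [lor_hvec_self] at k1 k2
  rw [lor_comm] at k2
  rw [k2] at k1
  -- Proportional points of the hyperboloid coincide.
  have k3 : k = 1 := by nlinarith
  have : z = x := eq_of_lor_hvec_eq_one (by rw [k2, k3, mul_one])
  rw [this]
  exact hx

/-- A reflection in the line of a side acts on Lorentz space as the orthogonal reflection. -/
theorem lor_reflection {v : ZMod 6 → ℍ} (hv : IsRightAngledHexagon v) {i : ZMod 6} {r : ℍ ≃ᵢ ℍ} (hr : IsReflection r (geodesicLine (v i) (v (i + 1))))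
    (z : ℍ) (w : ℝ × ℝ × ℝ) :
    lor (hvec (r z)) w = lor (hvec z) w + 2 * height v i z * lor (sideNormal v i) w := by
  have hfix : ∀ x, height v i x = 0 → r x = x := fun x hx =>
    (hr x).2 ((hv.mem_geodesicLine_iff i x).2 hx)
  have hd : ∀ x, height v i x = 0 → lor (hvec (r z)) (hvec x) = lor (hvec z) (hvec x) := by
    intro x hx
    rw [lor_hvec, lor_hvec]
    conv_lhs => rw [← hfix x hx]
    rw [r.isometry.dist_eq]
  have hF := hv.isFrame i
  have d0 := hd _ (hv.height_left i)
  have d1 := hd _ (hv.height_right i)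
  have hne : lor (hvec (v i)) (sideNormal v (i + 1)) ≠ 0 := by
    rw [lor_comm]
    exact (hv.height_vertex_pos (by clear * -; decide +revert) (by clear * -; decide +revert)).ne'
  have hz0 : lor (hvec (v i)) (sideNormal v i) = 0 := by
    rw [lor_comm]; exact hv.height_left i
  rw [hF.lor_eq (hvec (r z)) (hvec (v i)), hF.lor_eq (hvec z) (hvec (v i)), hz0, d1] at d0
  have d2 : lor (hvec (r z)) (sideNormal v (i + 1)) = lor (hvec z) (sideNormal v (i + 1)) := by
    apply mul_right_cancel₀ hne
    linear_combination -d0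
  have n1 := hF.lor_eq (hvec (r z)) (hvec (r z))
  have n2 := hF.lor_eq (hvec z) (hvec z)
  rw [lor_hvec_self, d1, d2] at n1
  rw [lor_hvec_self] at n2
  have sq : lor (hvec (r z)) (sideNormal v i) ^ 2 = lor (hvec z) (sideNormal v i) ^ 2 := by
    linear_combination n1 - n2
  -- Distances to the two fixed vertices determine the tangential coordinates, and the norm
  -- determines the normal one up to sign. An unchanged sign makes `z` fixed, hence on the line,
  -- where the coordinate is zero.
  have d3 : lor (hvec (r z)) (sideNormal v i) = -lor (hvec z) (sideNormal v i) := by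
    rcases sq_eq_sq_iff_eq_or_eq_neg.1 sq with h | h
    · have : lor (hvec (r z)) (hvec z) = 1 := by
        rw [hF.lor_eq, d1, d2, h]; exact n2.symm
      have := eq_of_lor_hvec_eq_one this
      have h0 : lor (hvec z) (sideNormal v i) = 0 := by
        rw [lor_comm]
        exact (hv.mem_geodesicLine_iff i z).1 ((hr z).1 this)
      rw [h, h0, neg_zero]
    · exact h
  rw [hF.lor_eq (hvec (r z)) w, hF.lor_eq (hvec z) w, d1, d2, d3, height,
    lor_comm (sideNormal v i) (hvec z), lor_comm (sideNormal v i) w]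
  ring

theorem height_reflection {v : ZMod 6 → ℍ} (hv : IsRightAngledHexagon v) {i : ZMod 6} {r : ℍ ≃ᵢ ℍ}
    (hr : IsReflection r (geodesicLine (v i) (v (i + 1)))) (z : ℍ) (j : ZMod 6) :
    height v j (r z) = height v j z
      + 2 * height v i z * lor (sideNormal v i) (sideNormal v j) := by
  have := hv.lor_reflection hr z (sideNormal v j)
  rwa [lor_comm, lor_comm (hvec z)] at this

theorem height_reflection_self {v : ZMod 6 → ℍ} (hv : IsRightAngledHexagon v) {i : ZMod 6} {r : ℍ ≃ᵢ ℍ}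
    (hr : IsReflection r (geodesicLine (v i) (v (i + 1)))) (z : ℍ) :
    height v i (r z) = -height v i z := by
  rw [hv.height_reflection hr, hv.lor_normal_self]; ring

/-- This gives both that reflections are involutions and that each side has at most one. -/
theorem reflection_mul_reflection {v : ZMod 6 → ℍ} (hv : IsRightAngledHexagon v) {i : ZMod 6} {r r' : ℍ ≃ᵢ ℍ}
    (hr : IsReflection r (geodesicLine (v i) (v (i + 1))))
    (hr' : IsReflection r' (geodesicLine (v i) (v (i + 1)))) : r * r' = 1 := by
  ext1 z
  show r (r' z) = z
  apply eq_of_lor_hvec_eq_one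
  rw [hv.lor_reflection hr, hv.lor_reflection hr', hv.height_reflection_self hr', lor_hvec_self]
  ring

end IsRightAngledHexagon

/-! ### Reduced words, ping-pong and discreteness -/

theorem add_two_mem_altSides {i : ZMod 6} (hi : i ∈ altSides) : i + 2 ∈ altSides := by
  simp only [altSides, Set.mem_insert_iff, Set.mem_singleton_iff] at *
  revert i; decide

theorem eq_or_eq_of_mem_altSides {i j : ZMod 6} (hi : i ∈ altSides) (hj : j ∈ altSides) :
    j = i ∨ j = i + 2 ∨ j = i + 4 := by
  simp only [altSides, Set.mem_insert_iff, Set.mem_singleton_iff] at *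
  revert i j; decide

/-- The intersection of the half-planes bounded by the sides `1, 3, 5`. -/
def hull (v : ZMod 6 → ℍ) : Set ℍ := {z | ∀ i ∈ altSides, 0 ≤ height v (i + 1) z}

/-- The generators of the reflection group. -/
def reflections (v : ZMod 6 → ℍ) : Set (ℍ ≃ᵢ ℍ) :=
  {r | ∃ i ∈ altSides, IsReflection r (geodesicLine (v i) (v (i + 1)))}

/-- A word in the generators without two equal consecutive letters. -/
def IsReduced (v : ZMod 6 → ℍ) (l : List (ℍ ≃ᵢ ℍ)) : Prop :=
  (∀ r ∈ l, r ∈ reflections v) ∧ l.IsChain (· ≠ ·)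

theorem height_sub_one_nonneg {v : ZMod 6 → ℍ} {z : ℍ} (hz : z ∈ hull v) {i : ZMod 6}
    (hi : i ∈ altSides) : 0 ≤ height v (i - 1) z := by
  have := hz _ (add_two_mem_altSides (add_two_mem_altSides hi))
  rwa [show i + 2 + 2 + 1 = i - 1 by clear * -; decide +revert] at this

theorem continuous_orient (p q : ℍ) : Continuous (orient p q) := by
  have h1 : Continuous fun z : ℍ => Complex.normSq (z : ℂ) :=
    Complex.continuous_normSq.comp UpperHalfPlane.continuous_coe
  have h2 : Continuous fun z : ℍ => z.re := UpperHalfPlane.continuous_re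
  unfold orient
  fun_prop

theorem isClosed_geodesicSegment (p q : ℍ) : IsClosed (geodesicSegment p q) :=
  isClosed_eq (by fun_prop) continuous_const

theorem left_mem_geodesicSegment (p q : ℍ) : p ∈ geodesicSegment p q := by
  simp [geodesicSegment]

theorem dist_le_of_mem_geodesicSegment {p q x y : ℍ} (hx : x ∈ geodesicSegment p q)
    (hy : y ∈ geodesicSegment p q) : dist x y ≤ dist p q := by
  have h1 : dist p x + dist x q = dist p q := hx
  have h2 : dist p y + dist y q = dist p q := hy
  have h3 := dist_triangle_left x y p
  have h4 := dist_triangle_right x y q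
  linarith

theorem exists_foot {v : ZMod 6 → ℍ} (i : ZMod 6) (o : ℍ) :
    ∃ f ∈ side v i, dist o f = Metric.infDist o (side v i) := by
  obtain ⟨f, hf, h⟩ := (isClosed_geodesicSegment (v i) (v (i + 1))).exists_infDist_eq_dist
    ⟨_, left_mem_geodesicSegment _ _⟩ o
  exact ⟨f, hf, h.symm⟩

theorem dist_reflection_le {v : ZMod 6 → ℍ} {o : ℍ} {C : ℝ}
    (hC : ∀ i ∈ altSides, Metric.infDist o (side v i) = C) :
    ∀ r ∈ reflections v, dist o (r o) ≤ 2 * C := by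
  rintro r ⟨i, hi, hr⟩
  obtain ⟨f, hf, hof⟩ := exists_foot (v := v) i o
  rw [hC i hi] at hof
  have h1 : r f = f := (hr f).2 (orient_eq_zero_of_mem_geodesicSegment hf)
  have h2 := r.isometry.dist_eq o f
  rw [h1] at h2
  have := dist_triangle_right o (r o) f
  linarith

theorem dist_side_le {v : ZMod 6 → ℍ} {o : ℍ} {C L : ℝ}
    (hlen : ∀ i ∈ altSides, dist (v i) (v (i + 1)) = L)
    (hC : ∀ i ∈ altSides, Metric.infDist o (side v i) = C) :
    ∀ i ∈ altSides, ∀ x ∈ side v i, dist o x ≤ C + L := by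
  intro i hi x hx
  obtain ⟨f, hf, hof⟩ := exists_foot (v := v) i o
  rw [hC i hi] at hof
  have h1 := dist_le_of_mem_geodesicSegment hf hx
  rw [hlen i hi] at h1
  have := dist_triangle o f x
  linarith

namespace IsRightAngledHexagon

theorem height_pos_of_height_nonpos {v : ZMod 6 → ℍ} (hv : IsRightAngledHexagon v) {i j : ZMod 6}
    (hi : i ∈ altSides) (hj : j ∈ altSides) (hij : i ≠ j) {z : ℍ} (hz : height v i z ≤ 0) :
    0 < height v j z := by
  rcases eq_or_eq_of_mem_altSides hi hj with h | h | h
  · exact absurd h.symm hij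
  · have := hv.height_add_height_pos i z
    rw [h]; linarith
  · have := hv.height_add_height_pos j z
    rw [show j + 2 = i by rw [h]; clear * -; decide +revert] at this
    linarith

theorem mul_self_eq_one {v : ZMod 6 → ℍ} (hv : IsRightAngledHexagon v) {r : ℍ ≃ᵢ ℍ}
    (hr : r ∈ reflections v) : r * r = 1 := by
  obtain ⟨i, -, h⟩ := hr
  exact hv.reflection_mul_reflection h h

theorem inv_eq_self {v : ZMod 6 → ℍ} (hv : IsRightAngledHexagon v) {r : ℍ ≃ᵢ ℍ}
    (hr : r ∈ reflections v) : r⁻¹ = r := inv_eq_of_mul_eq_one_left (hv.mul_self_eq_one hr)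

theorem exists_isReduced {v : ZMod 6 → ℍ} (hv : IsRightAngledHexagon v) {g : ℍ ≃ᵢ ℍ}
    (hg : g ∈ reflectionGroup v) : ∃ l, IsReduced v l ∧ l.prod = g := by
  have key : ∀ r ∈ reflections v, ∀ y : ℍ ≃ᵢ ℍ, (∃ l, IsReduced v l ∧ l.prod = y) →
      ∃ l, IsReduced v l ∧ l.prod = r * y := by
    rintro r hr y ⟨l, hl, rfl⟩
    rcases l with - | ⟨s, l⟩
    · exact ⟨[r], ⟨by simpa using hr, by simp⟩, by simp⟩
    · by_cases hrs : r = s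
      · refine ⟨l, ⟨fun x hx => hl.1 x (List.mem_cons_of_mem _ hx), hl.2.tail⟩, ?_⟩
        rw [List.prod_cons, ← mul_assoc, ← hrs, hv.mul_self_eq_one hr, one_mul]
      · refine ⟨r :: s :: l, ⟨?_, List.isChain_cons_cons.2 ⟨hrs, hl.2⟩⟩, by simp⟩
        intro x hx
        rcases List.mem_cons.1 hx with h | h
        · exact h ▸ hr
        · exact hl.1 x h
  induction hg using Subgroup.closure_induction_left with
  | one => exact ⟨[], ⟨by simp, by simp⟩, by simp⟩
  | mul_left x hx y hy ih => exact key x hx y ih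
  | inv_mul_cancel x hx y hy ih =>
    rw [hv.inv_eq_self hx]
    exact key x hx y ih

/-- Induction on the word. The next letter differs from `r`, so the shorter word leaves `o` on the
inner side of the side of `r`, and `r` carries it across. Heights over the two neighbours are
unchanged because these sides are perpendicular to the mirror; the opposite side is handled by
`height_add_three_pos`. -/
theorem ping_pong {v : ZMod 6 → ℍ} (hv : IsRightAngledHexagon v) {o : ℍ} (ho : o ∈ hull v)
    (hpos : ∀ i ∈ altSides, 0 < height v i o) {l : List (ℍ ≃ᵢ ℍ)} (hl : IsReduced v l) :
    l.prod o ∈ hull v ∧ ∀ i ∈ altSides, ((∀ r ∈ l.head?,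
      ¬ IsReflection r (geodesicLine (v i) (v (i + 1)))) → 0 < height v i (l.prod o)) ∧
      ((∃ r ∈ l.head?, IsReflection r (geodesicLine (v i) (v (i + 1)))) →
        height v i (l.prod o) < 0) := by
  induction l with
  | nil => exact ⟨ho, fun i hi => ⟨fun _ => hpos i hi, by simp⟩⟩
  | cons r l ih =>
    obtain ⟨hz, hlt⟩ := ih ⟨fun x hx => hl.1 x (List.mem_cons_of_mem _ hx), hl.2.tail⟩
    set z := l.prod o with hzdef
    have hp : (r :: l).prod o = r z := by rw [List.prod_cons]; rfl
    have neg : ∀ i ∈ altSides, IsReflection r (geodesicLine (v i) (v (i + 1))) →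
        height v i (r z) < 0 := by
      intro i hi hr
      rw [hv.height_reflection_self hr, neg_neg_iff_pos]
      refine (hlt i hi).1 fun s hs hs' => ?_
      have h1 : r ≠ s := by
        rcases l with - | ⟨t, l⟩
        · simp at hs
        · rw [List.head?_cons, Option.mem_some_iff] at hs
          exact hs ▸ (List.isChain_cons_cons.1 hl.2).1
      have h2 := hv.reflection_mul_reflection hr hs'
      rw [← hv.mul_self_eq_one (hl.1 r List.mem_cons_self)] at h2
      exact h1 (mul_left_cancel h2).symm
    obtain ⟨i, hi, hr⟩ := hl.1 r List.mem_cons_self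
    have hneg := neg i hi hr
    have k1 : height v (i + 1) (r z) = height v (i + 1) z := by
      rw [hv.height_reflection hr, hv.lor_normal_succ]; ring
    have k2 : height v (i - 1) (r z) = height v (i - 1) z := by
      have := hv.lor_normal_succ (i - 1)
      rw [sub_add_cancel] at this
      rw [hv.height_reflection hr, lor_comm, this]; ring
    have p1 : 0 ≤ height v (i + 1) (r z) := k1 ▸ hz i hi
    have p2 : 0 ≤ height v (i - 1) (r z) := k2 ▸ height_sub_one_nonneg hz hi
    rw [hp]
    refine ⟨fun j hj => ?_, fun j hj => ⟨fun hne => ?_, ?_⟩⟩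
    · rcases eq_or_eq_of_mem_altSides hi hj with h | h | h
      · rwa [h]
      · have := hv.height_add_three_pos hneg p1 p2
        rw [h, add_assoc]; norm_num; exact this.le
      · rwa [show j + 1 = i - 1 by rw [h]; clear * -; decide +revert]
    · have hij : i ≠ j := fun h => hne r (by simp) (h ▸ hr)
      exact hv.height_pos_of_height_nonpos hi hj hij hneg.le
    · rintro ⟨s, hs, hs'⟩
      rw [List.head?_cons, Option.mem_some_iff] at hs
      exact neg j hj (hs ▸ hs')

theorem reverse_prod {v : ZMod 6 → ℍ} (hv : IsRightAngledHexagon v) {l : List (ℍ ≃ᵢ ℍ)}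
    (hl : ∀ r ∈ l, r ∈ reflections v) : l.reverse.prod = l.prod⁻¹ := by
  induction l with
  | nil => simp
  | cons r l ih =>
    rw [List.reverse_cons, List.prod_append, ih fun x hx => hl x (List.mem_cons_of_mem _ hx),
      List.prod_singleton, List.prod_cons, mul_inv_rev, hv.inv_eq_self (hl r List.mem_cons_self)]

/-- Orbit points along a word lie coarsely on a geodesic. -/
theorem dist_add_dist_le {v : ZMod 6 → ℍ} (hv : IsRightAngledHexagon v) {o : ℍ} (ho : o ∈ hull v)
    (hpos : ∀ i ∈ altSides, 0 < height v i o) {D : ℝ} (hD0 : 0 ≤ D)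
    (hD : ∀ i ∈ altSides, ∀ x ∈ side v i, dist o x ≤ D) {l m : List (ℍ ≃ᵢ ℍ)}
    (hlm : IsReduced v (l ++ m)) :
    dist o (l.prod o) + dist (l.prod o) ((l ++ m).prod o) ≤ dist o ((l ++ m).prod o) + 2 * D := by
  rcases List.eq_nil_or_concat l with rfl | ⟨l, r, rfl⟩
  · simp; positivity
  rw [List.concat_eq_append] at *
  set w := (l ++ [r]) with hw
  obtain ⟨hc1, hc2, hc3⟩ := List.isChain_append.1 hlm.2
  have hwr : ∀ s ∈ w, s ∈ reflections v := fun s hs => hlm.1 s (List.mem_append_left _ hs)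
  have hrev : IsReduced v w.reverse := by
    refine ⟨fun s hs => hwr s (List.mem_reverse.1 hs), List.isChain_reverse.2 ?_⟩
    exact hc1.imp fun a b h => h.symm
  have hm : IsReduced v m := ⟨fun s hs => hlm.1 s (List.mem_append_right _ hs), hc2⟩
  have hr := hwr r (by simp [hw])
  obtain ⟨i, hi, hri⟩ := id hr
  obtain ⟨pH, p2⟩ := hv.ping_pong ho hpos hrev
  obtain ⟨qH, q2⟩ := hv.ping_pong ho hpos hm
  have hp : height v i (w.reverse.prod o) < 0 :=
    (p2 i hi).2 ⟨r, by simp [hw], hri⟩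
  have hq : 0 < height v i (m.prod o) := by
    refine (q2 i hi).1 fun s hs hs' => ?_
    have h1 : r ≠ s := hc3 r (by simp [hw]) s hs
    have h2 := hv.reflection_mul_reflection hri hs'
    rw [← hv.mul_self_eq_one hr] at h2
    exact h1 (mul_left_cancel h2).symm
  -- Everything is pulled back by `w`: the points `p` and `q` correspond to `o` and the end of the
  -- word, and the line of side `i`, the mirror of the last letter of `w`, separates them.
  set p := w.reverse.prod o with hpdef
  set q := m.prod o with hqdef
  -- These weights make the height over side `i` vanish: `x` is the crossing point. Both endpoints
  -- are in the hull, so it lies on the side itself.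
  obtain ⟨x, hx, k, hk, hxw⟩ := exists_mem_geodesicSegment p q hq.le (neg_nonneg.2 hp.le)
    (by linarith)
  have hh : ∀ j, height v j x = k * (height v i q * height v j p + -height v i p * height v j q) := by
    intro j
    have := hxw (sideNormal v j)
    simp only [lor_comm _ (sideNormal v j)] at this
    exact this
  have hside : x ∈ side v i := by
    apply hv.mem_side_of_height
    · rw [hh]; ring
    · rw [hh]
      have := pH i hi
      have := qH i hi
      have := neg_pos.2 hp
      positivity
    · rw [hh]
      have := height_sub_one_nonneg pH hi
      have := height_sub_one_nonneg qH hi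
      have := neg_pos.2 hp
      positivity
  have hox := hD i hi x hside
  have hx' : dist p x + dist x q = dist p q := hx
  have hinv : w.prod p = o := by
    rw [hpdef, hv.reverse_prod hwr]
    exact IsometryEquiv.apply_inv_self _ _
  have hmul : (w ++ m).prod o = w.prod q := by
    rw [List.prod_append]; rfl
  have e1 : dist o (w.prod o) = dist p o := by
    have := w.prod.isometry.dist_eq p o
    rwa [hinv] at this
  have e2 : dist o (w.prod q) = dist p q := by
    have := w.prod.isometry.dist_eq p q
    rwa [hinv] at this
  rw [hmul, w.prod.isometry.dist_eq, e1, e2, ← hx']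
  have t1 := dist_triangle p x o
  have t2 := dist_triangle o x q
  rw [dist_comm x o] at t1
  linarith

/-- Along the prefixes of a reduced word, stop just before the distance from `o` first reaches `T`;
the next letter changes it by at most `c`. -/
theorem exists_mem_reflectionGroup_between {v : ZMod 6 → ℍ} (hv : IsRightAngledHexagon v) {o : ℍ}
    (ho : o ∈ hull v) (hpos : ∀ i ∈ altSides, 0 < height v i o) {D c T : ℝ} (hD0 : 0 ≤ D)
    (hD : ∀ i ∈ altSides, ∀ x ∈ side v i, dist o x ≤ D)
    (hc : ∀ r ∈ reflections v, dist o (r o) ≤ c) (hT : 0 < T) {g : ℍ ≃ᵢ ℍ}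
    (hg : g ∈ reflectionGroup v) (hgT : T ≤ dist o (g o)) :
    ∃ w ∈ reflectionGroup v, T - c ≤ dist o (w o) ∧ dist o (w o) < T ∧
      dist o (w o) + dist (w o) (g o) ≤ dist o (g o) + 2 * D := by
  have key : ∀ m l : List (ℍ ≃ᵢ ℍ), IsReduced v (l ++ m) → dist o (l.prod o) < T →
      T ≤ dist o ((l ++ m).prod o) → ∃ w ∈ reflectionGroup v, T - c ≤ dist o (w o) ∧
        dist o (w o) < T ∧
        dist o (w o) + dist (w o) ((l ++ m).prod o) ≤ dist o ((l ++ m).prod o) + 2 * D := by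
    intro m
    induction m with
    | nil => intro l _ h1 h2; rw [List.append_nil] at h2; exact absurd h2 (not_le.2 h1)
    | cons r m ih =>
      intro l hl h1 h2
      by_cases h3 : dist o ((l ++ [r]).prod o) < T
      · have := ih (l ++ [r])
        rw [List.append_assoc, List.singleton_append] at this
        exact this hl h3 h2
      · refine ⟨l.prod, Subgroup.list_prod_mem _ fun s hs =>
          Subgroup.subset_closure (hl.1 s (List.mem_append_left _ hs)), ?_, h1,
          hv.dist_add_dist_le ho hpos hD0 hD hl⟩
        have h4 : (l ++ [r]).prod o = l.prod (r o) := by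
          rw [List.prod_append, List.prod_singleton]; rfl
        rw [h4, not_lt] at h3
        have h5 := dist_triangle o (l.prod o) (l.prod (r o))
        rw [l.prod.isometry.dist_eq] at h5
        have h6 := hc r (hl.1 r (by simp))
        linarith
  obtain ⟨l, hl, rfl⟩ := hv.exists_isReduced hg
  have := key l [] (by simpa using hl) (by simpa using hT)
  rw [List.nil_append] at this
  exact this hgT

/-- A nonempty reduced word sends `o` across one of three lines, each at positive distance from `o`.
-/
theorem exists_le_dist {v : ZMod 6 → ℍ} (hv : IsRightAngledHexagon v) {o : ℍ} (ho : o ∈ hull v)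
    (hpos : ∀ i ∈ altSides, 0 < height v i o) :
    ∃ ε > 0, ∀ g ∈ reflectionGroup v, g o ≠ o → ε ≤ dist o (g o) := by
  have hopen : ∀ i ∈ altSides, ∃ ε > 0, ∀ z, dist z o < ε → 0 < height v i z := by
    intro i hi
    have : IsOpen {z | 0 < orient (v i) (v (i + 1)) z} :=
      isOpen_lt continuous_const (continuous_orient _ _)
    obtain ⟨ε, hε, h⟩ := Metric.isOpen_iff.1 this o ((hv.orient_pos_iff i o).2 (hpos i hi))
    exact ⟨ε, hε, fun z hz => (hv.orient_pos_iff i z).1 (h hz)⟩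
  obtain ⟨a, ha, ha'⟩ := hopen 0 (by simp [altSides])
  obtain ⟨b, hb, hb'⟩ := hopen 2 (by simp [altSides])
  obtain ⟨c, hc, hc'⟩ := hopen 4 (by simp [altSides])
  refine ⟨min a (min b c), lt_min ha (lt_min hb hc), fun g hg hne => ?_⟩
  obtain ⟨l, hl, rfl⟩ := hv.exists_isReduced hg
  rcases l with - | ⟨r, l⟩
  · simp at hne
  obtain ⟨i, hi, hr⟩ := hl.1 r List.mem_cons_self
  have h := ((hv.ping_pong ho hpos hl).2 i hi).2 ⟨r, by simp, hr⟩
  by_contra! hlt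
  rw [dist_comm, lt_min_iff, lt_min_iff] at hlt
  simp only [altSides, Set.mem_insert_iff, Set.mem_singleton_iff] at hi
  rcases hi with rfl | rfl | rfl
  · exact absurd h (ha' _ hlt.1).not_gt
  · exact absurd h (hb' _ hlt.2.1).not_gt
  · exact absurd h (hc' _ hlt.2.2).not_gt

theorem finite_orbitBall {v : ZMod 6 → ℍ} (hv : IsRightAngledHexagon v) {o : ℍ} (ho : o ∈ hull v)
    (hpos : ∀ i ∈ altSides, 0 < height v i o) (R : ℝ) :
    (orbitBall (reflectionGroup v) o R).Finite := by
  obtain ⟨ε, hε, h⟩ := hv.exists_le_dist ho hpos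
  have htb : TotallyBounded (Metric.ball o R) :=
    ((isCompact_closedBall o R).totallyBounded).subset Metric.ball_subset_closedBall
  obtain ⟨t, ht, hcov⟩ := Metric.totallyBounded_iff.1 htb (ε / 2) (half_pos hε)
  -- The orbit is `ε`-separated, so each ball of radius `ε / 2` holds at most one orbit point.
  have hsub : orbitBall (reflectionGroup v) o R ⊆
      ⋃ y ∈ t, orbit (reflectionGroup v) o ∩ Metric.ball y (ε / 2) := by
    rintro x ⟨hx, hxR⟩
    obtain ⟨y, hy, hxy⟩ := Set.mem_iUnion₂.1 (hcov hxR)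
    exact Set.mem_iUnion₂.2 ⟨y, hy, hx, hxy⟩
  refine (ht.biUnion fun y _ => Set.Subsingleton.finite ?_).subset hsub
  rintro _ ⟨⟨g, hg, rfl⟩, h1⟩ _ ⟨⟨g', hg', rfl⟩, h2⟩
  by_contra hne
  have hlt : dist (g o) (g' o) < ε := by
    have := dist_triangle_right (g o) (g' o) y
    rw [Metric.mem_ball] at h1 h2
    linarith
  have e : dist (g o) (g' o) = dist o ((g⁻¹ * g') o) := by
    rw [← g.isometry.dist_eq o]
    congr 1
    exact (IsometryEquiv.apply_inv_self g (g' o)).symm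
  rw [e] at hlt
  refine absurd hlt (h _ (mul_mem (inv_mem hg) hg') fun h0 => hne ?_).not_gt
  rw [h0, dist_self, dist_eq_zero] at e
  exact e

theorem mem_hull_of_mem_hexagon {v : ZMod 6 → ℍ} (hv : IsRightAngledHexagon v) {o : ℍ}
    (ho : o ∈ hexagon v) : o ∈ hull v := fun _ _ => (hv.orient_nonneg_iff _ _).1 (ho _)

/-- If `o` were on one side then `C = 0`, and `o` would lie on two alternate sides, whose lines are
disjoint. -/
theorem height_pos_of_equidistant {v : ZMod 6 → ℍ} (hv : IsRightAngledHexagon v) {o : ℍ}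
    (ho : o ∈ hexagon v) {C : ℝ} (hC : ∀ i ∈ altSides, Metric.infDist o (side v i) = C) :
    ∀ i ∈ altSides, 0 < height v i o := by
  intro i hi
  refine ((hv.orient_nonneg_iff i o).1 (ho i)).lt_of_ne fun h0 => ?_
  have hoi : o ∈ side v i := hv.mem_side_of_height h0.symm ((hv.orient_nonneg_iff _ o).1 (ho _))
    ((by
      have := ho (i - 1)
      exact (hv.orient_nonneg_iff _ o).1 this))
  have hC0 : C = 0 := by rw [← hC i hi, Metric.infDist_zero_of_mem hoi]
  obtain ⟨f, hf, hof⟩ := exists_foot (v := v) (i + 2) o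
  rw [hC _ (add_two_mem_altSides hi), hC0, dist_eq_zero] at hof
  have h2 := hv.height_eq_zero_of_mem_side hf
  rw [← hof] at h2
  have := hv.height_add_height_pos i o
  rw [h2, ← h0] at this
  norm_num at this

end IsRightAngledHexagon

/-! ### Submultiplicativity of the orbit count -/

theorem mem_orbitBall_self (Γ : Subgroup (ℍ ≃ᵢ ℍ)) (o : ℍ) {R : ℝ} (hR : 0 < R) :
    o ∈ orbitBall Γ o R :=
  ⟨⟨1, one_mem _, rfl⟩, by simpa using hR⟩

theorem orbitCount_pos {Γ : Subgroup (ℍ ≃ᵢ ℍ)} {o : ℍ} {R : ℝ} (hR : 0 < R)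
    (hfin : (orbitBall Γ o R).Finite) : 0 < orbitCount Γ o R :=
  (Set.ncard_pos hfin).2 ⟨o, mem_orbitBall_self Γ o hR⟩

/-- The orbit of `o` is coarsely geodesic: the way to any orbit point passes near an orbit point at
a prescribed distance from `o`. -/
def IsCoarselyGeodesic (Γ : Subgroup (ℍ ≃ᵢ ℍ)) (o : ℍ) (c b : ℝ) : Prop :=
  ∀ T : ℝ, 0 < T → ∀ g ∈ Γ, T ≤ dist o (g o) → ∃ w ∈ Γ, T - c ≤ dist o (w o) ∧ dist o (w o) < T ∧
    dist o (w o) + dist (w o) (g o) ≤ dist o (g o) + b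

theorem orbitCount_add_le {Γ : Subgroup (ℍ ≃ᵢ ℍ)} {o : ℍ} {c b : ℝ}
    (hΓ : IsCoarselyGeodesic Γ o c b) (hfin : ∀ R, (orbitBall Γ o R).Finite) {R T : ℝ}
    (hR : 0 < R) (hT : 0 < T) :
    orbitCount Γ o (T + (R - (c + b))) ≤ orbitCount Γ o R * orbitCount Γ o T := by
  -- Points are counted, not group elements, so one element is chosen for each orbit point.
  have hs : ∀ x ∈ orbit Γ o, ∃ g : ℍ ≃ᵢ ℍ, g ∈ Γ ∧ g o = x := fun x hx => hx
  choose! s hsΓ hso using hs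
  have hsub : orbitBall Γ o (T + (R - (c + b))) ⊆
      (fun p : ℍ × ℍ => s p.1 p.2) '' (orbitBall Γ o R ×ˢ orbitBall Γ o T) := by
    rintro _ ⟨⟨g, hg, rfl⟩, hgR⟩
    have hw : ∃ w ∈ Γ, dist o (w o) < R ∧ dist (w o) (g o) < T := by
      by_cases h : dist o (g o) < R
      · exact ⟨g, hg, h, by simpa using hT⟩
      · obtain ⟨w, hw, h1, h2, h3⟩ := hΓ R hR g hg (not_lt.1 h)
        rw [Metric.mem_ball, dist_comm] at hgR
        -- The remaining distance is less than `T + (R - c - b) + b - (R - c) = T`.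
        exact ⟨w, hw, h2, by linarith⟩
    obtain ⟨w, hw, h1, h2⟩ := hw
    have hwo : w o ∈ orbit Γ o := ⟨w, hw, rfl⟩
    refine ⟨(w o, (s (w o))⁻¹ (g o)), ⟨⟨hwo, ?_⟩, ⟨_, mul_mem (inv_mem (hsΓ _ hwo)) hg, rfl⟩, ?_⟩, ?_⟩
    · rwa [Metric.mem_ball, dist_comm]
    · rw [Metric.mem_ball, dist_comm, ← (s (w o)).isometry.dist_eq, hso _ hwo]
      simpa [IsometryEquiv.apply_inv_self] using h2
    · exact IsometryEquiv.apply_inv_self _ _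
  have hprod := (hfin R).prod (hfin T)
  calc _ ≤ _ := Set.ncard_le_ncard hsub (hprod.image _)
    _ ≤ _ := Set.ncard_image_le hprod
    _ = _ := Set.ncard_prod

theorem orbitCount_mul_le {Γ : Subgroup (ℍ ≃ᵢ ℍ)} {o : ℍ} {c b : ℝ}
    (hΓ : IsCoarselyGeodesic Γ o c b) (hfin : ∀ R, (orbitBall Γ o R).Finite) {R : ℝ}
    (hR : 0 < R) (hcb : c + b < R) (n : ℕ) :
    orbitCount Γ o ((n + 1) * (R - (c + b))) ≤
      orbitCount Γ o R ^ n * orbitCount Γ o (R - (c + b)) := by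
  have hΔ : 0 < R - (c + b) := sub_pos.2 hcb
  induction n with
  | zero => simp
  | succ n ih =>
    have h := orbitCount_add_le hΓ hfin hR (T := (n + 1) * (R - (c + b))) (by positivity)
    calc _ = orbitCount Γ o ((n + 1) * (R - (c + b)) + (R - (c + b))) := by
          congr 1; push_cast; ring
      _ ≤ _ := h
      _ ≤ orbitCount Γ o R * (orbitCount Γ o R ^ n * orbitCount Γ o (R - (c + b))) :=
          Nat.mul_le_mul_left _ ih
      _ = _ := by rw [pow_succ']; ring

/-! ### Euclidean distances in the disk and shadowing of limit points -/

theorem norm_coe_sub (z w : ℍ) :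
    ‖(z : ℂ) - w‖ = 2 * √z.im * √w.im * Real.sinh (dist z w / 2) := by
  have hz := z.im_pos
  have hw := w.im_pos
  rw [UpperHalfPlane.sinh_half_dist, Complex.dist_eq, Real.sqrt_mul hz.le]
  field_simp

theorem norm_coe_add_I (z : ℍ) :
    ‖(z : ℂ) + Complex.I‖ = 2 * √z.im * Real.cosh (dist z UpperHalfPlane.I / 2) := by
  have hz := z.im_pos
  rw [UpperHalfPlane.cosh_half_dist, Complex.dist_eq]
  simp
  field_simp

theorem norm_cayley_sub (z w : ℍ) : ‖cayley z - cayley w‖ = Real.sinh (dist z w / 2) /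
    (Real.cosh (dist z UpperHalfPlane.I / 2) * Real.cosh (dist w UpperHalfPlane.I / 2)) := by
  have hz := z.im_pos
  have hw := w.im_pos
  have cz := Real.cosh_pos (dist z UpperHalfPlane.I / 2)
  have cw := Real.cosh_pos (dist w UpperHalfPlane.I / 2)
  have nz : (z : ℂ) + Complex.I ≠ 0 := by
    rw [← norm_pos_iff, norm_coe_add_I]; positivity
  have nw : (w : ℂ) + Complex.I ≠ 0 := by
    rw [← norm_pos_iff, norm_coe_add_I]; positivity
  have h : cayley z - cayley w =
      2 * Complex.I * (z - w) / ((z + Complex.I) * (w + Complex.I)) := by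
    simp only [cayley]
    field_simp
    ring
  rw [h, norm_div, norm_mul, norm_mul, norm_mul, norm_coe_sub, norm_coe_add_I, norm_coe_add_I]
  simp
  field_simp

theorem one_sub_norm_cayley_sq (z : ℍ) :
    (1 - ‖cayley z‖ ^ 2) * Real.cosh (dist z UpperHalfPlane.I / 2) ^ 2 = 1 := by
  have h := norm_cayley_sub z UpperHalfPlane.I
  have h0 : cayley UpperHalfPlane.I = 0 := by simp [cayley]
  rw [h0, sub_zero, dist_self, zero_div, Real.cosh_zero, mul_one] at h
  have cz := Real.cosh_pos (dist z UpperHalfPlane.I / 2)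
  rw [h, div_pow, sub_mul, div_mul_cancel₀ _ (by positivity), one_mul, Real.cosh_sq]
  ring

/-- The exponent is minus the Gromov product of `z` and `w` based at `I`. -/
theorem norm_cayley_sub_le (z w : ℍ) : ‖cayley z - cayley w‖ ≤
    2 * Real.exp ((dist z w - dist z UpperHalfPlane.I - dist w UpperHalfPlane.I) / 2) := by
  have h1 : Real.sinh (dist z w / 2) ≤ Real.exp (dist z w / 2) / 2 := by
    rw [Real.sinh_eq]
    have := Real.exp_pos (-(dist z w / 2))
    linarith
  have h2 : ∀ x : ℍ, Real.exp (dist x UpperHalfPlane.I / 2) / 2 ≤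
      Real.cosh (dist x UpperHalfPlane.I / 2) := by
    intro x
    rw [Real.cosh_eq]
    have := Real.exp_pos (-(dist x UpperHalfPlane.I / 2))
    linarith
  rw [norm_cayley_sub]
  calc _ ≤ (Real.exp (dist z w / 2) / 2) / (Real.exp (dist z UpperHalfPlane.I / 2) / 2 *
        (Real.exp (dist w UpperHalfPlane.I / 2) / 2)) := by
        have a := h2 z
        have b := h2 w
        gcongr
    _ = _ := by
      rw [show (dist z w - dist z UpperHalfPlane.I - dist w UpperHalfPlane.I) / 2 =
        dist z w / 2 - dist z UpperHalfPlane.I / 2 - dist w UpperHalfPlane.I / 2 by ring,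
        Real.exp_sub, Real.exp_sub]
      field_simp

theorem le_cosh_of_norm_cayley_sub_lt {ξ : ℂ} (hξ : ‖ξ‖ = 1) {z : ℍ} {M : ℝ} (hM : 0 < M)
    (h : ‖cayley z - ξ‖ < 1 / (2 * M ^ 2)) : M ≤ Real.cosh (dist z UpperHalfPlane.I / 2) := by
  have h1 := one_sub_norm_cayley_sq z
  have h2 : 1 - ‖cayley z‖ ≤ ‖cayley z - ξ‖ := by
    rw [← hξ, norm_sub_rev]; exact norm_sub_norm_le _ _
  set x := ‖cayley z‖
  have cz := Real.cosh_pos (dist z UpperHalfPlane.I / 2)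
  set y := Real.cosh (dist z UpperHalfPlane.I / 2)
  have h3 : 1 - x ^ 2 ≤ 2 * (1 - x) := by nlinarith [sq_nonneg (1 - x)]
  have h4 : 1 - x ^ 2 ≤ 1 / M ^ 2 := by
    have : 2 * (1 / (2 * M ^ 2)) = 1 / M ^ 2 := by field_simp
    linarith
  have h5 : M ^ 2 ≤ y ^ 2 := by
    have : 1 ≤ 1 / M ^ 2 * y ^ 2 := h1.symm.le.trans (by gcongr)
    rwa [one_div, ← div_eq_inv_mul, one_le_div (by positivity)] at this
  exact (pow_le_pow_iff_left₀ hM.le cz.le two_ne_zero).1 h5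

/-- Limit points are shadowed by orbit points at every scale. -/
theorem exists_norm_cayley_sub_le {Γ : Subgroup (ℍ ≃ᵢ ℍ)} {o : ℍ} {c b : ℝ}
    (hΓ : IsCoarselyGeodesic Γ o c b) {T : ℝ} (hT : 0 < T) {ξ : ℂ} (hξ : ξ ∈ limitSet Γ) :
    ∃ x ∈ orbitBall Γ o T, ‖cayley x - ξ‖ ≤
      (2 * Real.exp (b / 2 + c + dist o UpperHalfPlane.I) + 2) * Real.exp (-T) := by
  obtain ⟨hξ1, z, hz⟩ := hξ
  set a := dist o UpperHalfPlane.I with ha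
  -- The first entry brings the images of `g z` and `g o` within `exp (-T)` of each other; the
  -- second forces `g o` to distance at least `T` from `o`.
  set M := max (Real.sinh (dist z o / 2) * Real.exp T) (Real.cosh ((T + a + dist z o) / 2)) with hM
  have hM1 : 1 ≤ M := le_max_of_le_right (Real.one_le_cosh _)
  have hM0 : 0 < M := by linarith
  obtain ⟨_, ⟨_, ⟨g, hg, rfl⟩, rfl⟩, hd⟩ := Metric.mem_closure_iff.1 hz
    (min (Real.exp (-T)) (1 / (2 * M ^ 2))) (lt_min (Real.exp_pos _) (by positivity))
  rw [dist_comm, dist_eq_norm, lt_min_iff] at hd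
  obtain ⟨hd1, hd2⟩ := hd
  have hcosh := le_cosh_of_norm_cayley_sub_lt hξ1 hM0 hd2
  have hdist : T + a + dist z o ≤ dist (g z) UpperHalfPlane.I := by
    have h1 := (le_max_right _ _).trans hcosh
    rw [Real.cosh_le_cosh, abs_of_nonneg (by positivity), abs_of_nonneg (by positivity)] at h1
    linarith
  have hgz : dist (g z) (g o) = dist z o := g.isometry.dist_eq _ _
  have hgT : T ≤ dist o (g o) := by
    have h1 := dist_triangle (g z) (g o) UpperHalfPlane.I
    have h2 := dist_triangle_left (g o) UpperHalfPlane.I o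
    linarith
  obtain ⟨w, hw, h1, h2, h3⟩ := hΓ T hT g hg hgT
  refine ⟨w o, ⟨⟨w, hw, rfl⟩, by rwa [Metric.mem_ball, dist_comm]⟩, ?_⟩
  have e1 : ‖cayley (g o) - cayley (g z)‖ ≤ Real.exp (-T) := by
    rw [norm_sub_rev, norm_cayley_sub, hgz, Real.exp_neg]
    have hs : 0 ≤ Real.sinh (dist z o / 2) := Real.sinh_nonneg_iff.2 (by positivity)
    have hc1 := Real.one_le_cosh (dist (g o) UpperHalfPlane.I / 2)
    have hE := Real.exp_pos T
    rw [div_le_iff₀ (by positivity), inv_mul_eq_div, le_div_iff₀ hE]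
    calc _ ≤ M := le_max_left _ _
      _ ≤ _ := hcosh
      _ ≤ _ := le_mul_of_one_le_right (Real.cosh_pos _).le hc1
  -- The Gromov product of `w o` and `g o` based at `o` is at least `T - c - b / 2`; moving the base
  -- point to `I` costs at most `a`.
  have e2 : ‖cayley (w o) - cayley (g o)‖ ≤ 2 * Real.exp (b / 2 + c + a) * Real.exp (-T) := by
    refine (norm_cayley_sub_le _ _).trans ?_
    rw [mul_assoc, ← Real.exp_add]
    have t1 := dist_triangle_right o (w o) UpperHalfPlane.I
    have t2 := dist_triangle_right o (g o) UpperHalfPlane.I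
    have t1' := dist_triangle o UpperHalfPlane.I (w o)
    have t2' := dist_triangle o UpperHalfPlane.I (g o)
    rw [dist_comm UpperHalfPlane.I] at t1' t2'
    gcongr
    linarith
  have := norm_sub_le_norm_sub_add_norm_sub (cayley (w o)) (cayley (g o)) ξ
  have := norm_sub_le_norm_sub_add_norm_sub (cayley (g o)) (cayley (g z)) ξ
  linarith

/-! ### Hausdorff dimension of the limit set -/

theorem dimH_limitSet_le_one (Γ : Subgroup (ℍ ≃ᵢ ℍ)) : dimH (limitSet Γ) ≤ 1 := by
  have hsub : limitSet Γ ⊆ Set.range fun t : ℝ => Complex.exp (t * Complex.I) := by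
    rintro ξ ⟨hξ, -⟩
    refine ⟨Complex.arg ξ, ?_⟩
    have := Complex.norm_mul_exp_arg_mul_I ξ
    rwa [hξ, Complex.ofReal_one, one_mul] at this
  have hd : ContDiff ℝ 1 fun t : ℝ => Complex.exp (t * Complex.I) :=
    (Complex.ofRealCLM.contDiff.mul contDiff_const).cexp
  refine (dimH_mono hsub).trans (hd.dimH_range_le.trans ?_)
  simp

theorem limitDim_le_one (Γ : Subgroup (ℍ ≃ᵢ ℍ)) : limitDim Γ ≤ 1 :=
  ENNReal.toReal_le_of_le_ofReal zero_le_one (by simpa using dimH_limitSet_le_one Γ)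

open Filter Topology MeasureTheory in
/-- A set that is covered at scale `ρ ^ n` by at most `A * m ^ n` balls has Hausdorff dimension at
most `s` if `m * ρ ^ s < 1`. -/
theorem dimH_le_of_covering {X : Type*} [MetricSpace X] {S : Set X}
    {A m K ρ : ℝ} (hm : 0 ≤ m) (hK : 0 < K) (hρ : 0 < ρ) (hρ1 : ρ < 1)
    (F : ℕ → Finset X) (hF : ∀ n, ((F n).card : ℝ) ≤ A * m ^ n)
    (hcov : ∀ n, ∀ ξ ∈ S, ∃ x ∈ F n, dist ξ x ≤ K * ρ ^ n) {s : NNReal}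
    (hs : m * ρ ^ (s : ℝ) < 1) : dimH S ≤ s := by
  borelize X
  have hlim1 : Tendsto (fun n : ℕ => ENNReal.ofReal (2 * (K * ρ ^ n))) atTop (𝓝 0) := by
    rw [← ENNReal.ofReal_zero]
    refine ENNReal.tendsto_ofReal ?_
    have := ((tendsto_pow_atTop_nhds_zero_of_lt_one hρ.le hρ1).const_mul K).const_mul 2
    simpa using this
  have hdiam : ∀ n, ∀ x : X, Metric.ediam (Metric.closedBall x (K * ρ ^ n)) ≤
      ENNReal.ofReal (2 * (K * ρ ^ n)) := by
    intro n x
    refine Metric.ediam_le fun y hy z hz => ?_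
    rw [edist_dist]
    apply ENNReal.ofReal_le_ofReal
    have := dist_triangle_right y z x
    rw [Metric.mem_closedBall] at hy hz
    linarith
  have hmeas := Measure.hausdorffMeasure_le_liminf_sum (s : ℝ) S (l := atTop)
    (ι := fun n : ℕ => F n) (fun n => ENNReal.ofReal (2 * (K * ρ ^ n))) hlim1
    (fun n x => Metric.closedBall (x : X) (K * ρ ^ n))
    (Eventually.of_forall fun n x => hdiam n x)
    (Eventually.of_forall fun n ξ hξ => by
      obtain ⟨x, hx, h⟩ := hcov n ξ hξ
      exact Set.mem_iUnion.2 ⟨⟨x, hx⟩, h⟩)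
  -- The `s`-sums of the covers are bounded by a geometric sequence tending to zero, so the
  -- `s`-dimensional measure vanishes.
  have hsum : ∀ n, ∑ x : F n, Metric.ediam (Metric.closedBall (x : X) (K * ρ ^ n)) ^ (s : ℝ) ≤
      ENNReal.ofReal (A * (2 * K) ^ (s : ℝ) * (m * ρ ^ (s : ℝ)) ^ n) := by
    intro n
    calc _ ≤ ∑ x : F n, ENNReal.ofReal (2 * (K * ρ ^ n)) ^ (s : ℝ) := by
          gcongr with x
          exact hdiam n x
      _ = ENNReal.ofReal ((F n).card * (2 * (K * ρ ^ n)) ^ (s : ℝ)) := by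
          rw [Finset.sum_const, nsmul_eq_mul, Finset.card_univ, Fintype.card_coe,
            ENNReal.ofReal_rpow_of_nonneg (by positivity) s.coe_nonneg,
            ENNReal.ofReal_mul (by positivity), ENNReal.ofReal_natCast]
      _ ≤ _ := by
          apply ENNReal.ofReal_le_ofReal
          have e : (2 * (K * ρ ^ n)) ^ (s : ℝ) = (2 * K) ^ (s : ℝ) * (ρ ^ (s : ℝ)) ^ n := by
            rw [← mul_assoc, Real.mul_rpow (by positivity) (by positivity), ← Real.rpow_natCast_mul
              hρ.le, ← Real.rpow_mul_natCast hρ.le, mul_comm (n : ℝ)]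
          rw [e, mul_pow]
          calc _ ≤ A * m ^ n * ((2 * K) ^ (s : ℝ) * (ρ ^ (s : ℝ)) ^ n) := by
                gcongr; exact hF n
            _ = _ := by ring
  have hlim2 : Tendsto (fun n : ℕ => ENNReal.ofReal
      (A * (2 * K) ^ (s : ℝ) * (m * ρ ^ (s : ℝ)) ^ n)) atTop (𝓝 0) := by
    rw [← ENNReal.ofReal_zero]
    refine ENNReal.tendsto_ofReal ?_
    have := (tendsto_pow_atTop_nhds_zero_of_lt_one (by positivity) hs).const_mul
      (A * (2 * K) ^ (s : ℝ))
    simpa using this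
  have h0 : μH[(s : ℝ)] S ≤ 0 := by
    rw [← hlim2.liminf_eq]
    exact hmeas.trans (liminf_le_liminf (Eventually.of_forall hsum))
  refine dimH_le_of_hausdorffMeasure_ne_top (ne_top_of_le_ne_top ENNReal.zero_ne_top h0)

theorem limitDim_mul_le_log_orbitCount {Γ : Subgroup (ℍ ≃ᵢ ℍ)} {o : ℍ} {c b : ℝ}
    (hΓ : IsCoarselyGeodesic Γ o c b) (hfin : ∀ R, (orbitBall Γ o R).Finite) {R : ℝ}
    (hR : 0 < R) (hcb : c + b < R) :
    limitDim Γ * (R - (c + b)) ≤ Real.log (orbitCount Γ o R) := by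
  classical
  set Δ := R - (c + b) with hΔ
  have hΔ0 : 0 < Δ := sub_pos.2 hcb
  have hN : (1 : ℝ) ≤ orbitCount Γ o R := by exact_mod_cast orbitCount_pos hR (hfin R)
  by_contra! hlt
  rw [← div_lt_iff₀ hΔ0] at hlt
  obtain ⟨s, hs1, hs2⟩ := exists_between hlt
  have hs0 : 0 ≤ s := (div_nonneg (Real.log_nonneg hN) hΔ0.le).trans hs1.le
  rw [div_lt_iff₀ hΔ0] at hs1
  have hfinT : ∀ n : ℕ, (orbitBall Γ o ((n + 1) * Δ)).Finite := fun n => hfin _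
  have hdim : dimH (limitSet Γ) ≤ (NNReal.mk s hs0 : ENNReal) := by
    -- The cover at step `n` uses orbit points within `(n + 1) * Δ`, a positive radius even for `n =
    -- 0`; the extra factor `exp (-Δ)` goes into `K`.
    refine dimH_le_of_covering (A := orbitCount Γ o Δ) (m := orbitCount Γ o R)
      (K := (2 * Real.exp (b / 2 + c + dist o UpperHalfPlane.I) + 2) * Real.exp (-Δ))
      (ρ := Real.exp (-Δ)) (by positivity) (by positivity) (Real.exp_pos _)
      (Real.exp_lt_one_iff.2 (by linarith)) (fun n => (hfinT n).toFinset.image cayley) ?_ ?_ ?_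
    · intro n
      have h1 : ((hfinT n).toFinset.image cayley).card ≤ orbitCount Γ o ((n + 1) * Δ) := by
        refine Finset.card_image_le.trans ?_
        rw [orbitCount, Set.ncard_eq_toFinset_card _ (hfinT n)]
      have h2 := (h1.trans (orbitCount_mul_le hΓ hfin hR hcb n)).trans_eq (mul_comm _ _)
      exact_mod_cast h2
    · intro n ξ hξ
      obtain ⟨x, hx, h⟩ := exists_norm_cayley_sub_le hΓ (T := (n + 1) * Δ) (by positivity) hξ
      refine ⟨cayley x, Finset.mem_image_of_mem _ ((hfinT n).mem_toFinset.2 hx), ?_⟩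
      rw [dist_comm, dist_eq_norm]
      refine h.trans_eq ?_
      rw [mul_assoc, ← Real.exp_nat_mul, ← Real.exp_add]
      congr 2
      ring
    · rw [← Real.exp_mul]
      show _ * Real.exp (-Δ * s) < 1
      rw [← Real.exp_log (by linarith : (0 : ℝ) < orbitCount Γ o R), ← Real.exp_add]
      exact Real.exp_lt_one_iff.2 (by linarith)
  have : limitDim Γ ≤ s := by
    refine ENNReal.toReal_le_of_le_ofReal hs0 (hdim.trans_eq ?_)
    rw [ENNReal.ofReal_eq_coe_nnreal hs0]
  linarith

end

end HexReflection

theorem mainTheorem3 (ℓ : ℝ) (hℓ : 1 ≤ ℓ)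
    (v : ZMod 6 → UpperHalfPlane) (hv : HexReflection.IsRightAngledHexagon v)
    (hlen : ∀ i ∈ HexReflection.altSides, dist (v i) (v (i + 1)) = ℓ / 2)
    (o : UpperHalfPlane) (ho : o ∈ HexReflection.hexagon v)
    (C : ℝ) (hC : ∀ i ∈ HexReflection.altSides, Metric.infDist o (HexReflection.side v i) = C)
    (R : ℝ) (hR : 0 < R) :
    (HexReflection.orbitBall (HexReflection.reflectionGroup v) o R).Finite ∧
      Real.log (HexReflection.orbitCount (HexReflection.reflectionGroup v) o R : ℝ) / R ≥
        HexReflection.limitDim (HexReflection.reflectionGroup v)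
          - (ℓ + 8 * C + Real.log (20 / 3)) / R := by
  have hH := hv.mem_hull_of_mem_hexagon ho
  have hpos := hv.height_pos_of_equidistant ho hC
  have hC0 : 0 ≤ C := by
    rw [← hC 0 (by simp [HexReflection.altSides])]; exact Metric.infDist_nonneg
  have hfin := hv.finite_orbitBall hH hpos
  have hΓ : HexReflection.IsCoarselyGeodesic (HexReflection.reflectionGroup v) o (2 * C)
      (2 * (C + ℓ / 2)) := fun T hT g hg hgT =>
    hv.exists_mem_reflectionGroup_between hH hpos (by positivity)
      (HexReflection.dist_side_le hlen hC)
      (HexReflection.dist_reflection_le hC) hT hg hgT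
  refine ⟨hfin R, ?_⟩
  set δ := HexReflection.limitDim (HexReflection.reflectionGroup v) with hδ
  have hδ1 : δ ≤ 1 := HexReflection.limitDim_le_one _
  have hN : (1 : ℝ) ≤ HexReflection.orbitCount (HexReflection.reflectionGroup v) o R := by
    exact_mod_cast HexReflection.orbitCount_pos hR (hfin R)
  have hlogN := Real.log_nonneg hN
  have hlog : 0 ≤ Real.log (20 / 3) := Real.log_nonneg (by norm_num)
  rw [ge_iff_le, sub_le_iff_le_add, ← add_div, le_div_iff₀ hR]
  -- The threshold is `c + b = ℓ + 4 * C`, so `4 * C + log (20 / 3)` is slack. Below the threshold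
  -- the bound is trivial, because `δ ≤ 1` and `log N ≥ 0`.
  by_cases hcb : 2 * C + 2 * (C + ℓ / 2) < R
  · have h := HexReflection.limitDim_mul_le_log_orbitCount hΓ hfin hR hcb
    rw [← hδ] at h
    have : δ * (2 * C + 2 * (C + ℓ / 2)) ≤ 2 * C + 2 * (C + ℓ / 2) :=
      mul_le_of_le_one_left (by positivity) hδ1
    linarith
  · have : δ * R ≤ R := mul_le_of_le_one_left hR.le hδ1
    linarith
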